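/- **Setting.** Let $n\ge 2$, $p\ge 1$ be integers and $\beta,\gamma\in\mathbf R^p$. Let $J=(J_{kl})_{0\le k<l<n}\sim\mathrm{SK}(n)$ have independent entries $J_{kl}\sim\mathcal N(0,1/n)$, let $H[J]=\sum_{k<l}J_{kl}Z_kZ_l$ and $H_B=\sum_kX_k$ on $n$ qubits, and let $$|\Psi(J,\beta,\gamma)\rangle=e^{-i\frac{\beta_{p-1}}2H_B}e^{-i\frac{\gamma_{p-1}}2H[J]}\cdots e^{-i\frac{\beta_0}2H_B}e^{-i\frac{\gamma_0}2H[J]}\,|+\rangle^{\otimes n}.$$ *Bitstrings.* For $s=s_0\dots s_{2p}\in\{0,1\}^{2p+1}$ let $L(s)$ be the largest $j\le p$ such that $s_{p+k}=s_{p-k}$ for all $0\le k\le j$; let $F(s)$ be $s$ with the bits $p-L(s),\dots,p+L(s)$ negated; call $s$ odd if $s_0\ne s_p$, and put $\epsilon_s=-1$ if $s$ is odd, $\epsilon_s=1$ otherwise. Let $\oplus$ be the bitwise XOR and $$B_s=\prod_{0\le j<p}b_j(s_j,s_{j+1})\,b_j(s_{2p-j},s_{2p-j-1}),\qquad b_j(x,y)=\begin{cases}\cos\frac{\beta_j}2&x=y\\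 i\sin\frac{\beta_j}2&x\ne y,\end{cases}$$ $$\varphi(s)=\sum_{0\le j<p}\frac{\gamma_j}2\left((-1)^{s_{2p-j}}-(-1)^{s_j}\right),\qquad C_s=e^{-\varphi(s)^2/(2n)}.$$ Let $\mathcal K$ be the set of odd strings $s$ with $L(s)<p$, and fix any enumeration of $\mathcal K$ (written $<$) along which $L$ is non-decreasing. *Sampling algorithm.* Independently for every ordered pair $(s,t)$ of bitstrings, a weight $M_{s,t}\in\mathbf C$ is drawn as follows. Start with weight $1$ and counts $m_u=0$ for all $u\in\mathcal K$. For $u\in\mathcal K$ in increasing order let $$\lambda=\frac{nB_u}2\left(-C_{s\oplus u}C_{t\oplus u}\prod_{v<u}C_{v\oplus u}^{m_v}+C_{s\oplus F(u)}C_{t\oplus F(u)}\prod_{v<u}C_{v\oplus F(u)}^{m_v}\right);$$ if $\lambda\ne0$, draw $m_u\sim\mathrm{Poisson}(|\lambda|)$ and multiply the weight by $e^{|\lambda|}(\lambda/|\lambda|)^{m_u}$. Finally, with $k=\sum_{v\in\mathcal K}m_v$, multiply the weight by $$\frac{n!}{(n-k-2)!\,n^{k+2}}\;C_{s\oplus t}\left(\frac12\sum_{u:\,L(u)=p}\epsilon_uB_u\,C_{s\oplus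 u}C_{t\oplus u}\prod_{v\in\mathcal K}C_{u\oplus v}^{m_v}\right)^{n-k-2}$$ (by $0$ if $k>n-2$). The output is $$E=\operatorname{Re}\left\{\frac i8\sum_{s,t}(-1)^{s_p+t_p}\,\epsilon_s\epsilon_t\,B_sB_t\,\varphi(s\oplus t)\,M_{s,t}\right\}.$$ *Bounding algorithm.* Given weights $w_t\ge0$ ($t\in\mathcal K$), set $\hat R_s=1$ if $L(s)=p$. For $s\in\mathcal K$ set $$\hat R_s,\hat R_{F(s)}\leftarrow\exp\left(\tfrac14\sum_{t\in\mathcal K}w_t\left|\varphi(s\oplus t)^2-\varphi(s\oplus F(t))^2\right|\right).$$ Then, for $s\in\mathcal K$ in decreasing order and each $t\in\mathcal K$ with $t<s$, set $$\hat R_t,\hat R_{F(t)}\leftarrow\hat R_t\exp\left(\tfrac14\hat R_s|B_s|\left|\varphi(t\oplus s)^2-\varphi(t\oplus F(s))^2\right|\right).$$ The output is $$\Delta(w)=\frac18\sum_{s,t}|\varphi(s\oplus t)|^2\,|B_s|\hat R_s\,|B_t|\hat R_t .$$ **Theorem.** The output $E$ of the sampling algorithm is a square-integrable random variable, the QAOA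 energy is integrable over $J\sim\mathrm{SK}(n)$, and $$\mathbf E[E]=\mathbf E_{J\sim\mathrm{SK}(n)}\left[\left\langle\Psi(J,\beta,\gamma)\left|\tfrac{H[J]}n\right|\Psi(J,\beta,\gamma)\right\rangle\right],\qquad \operatorname{Var}(E)\le\Delta(w),$$ where the variance bound holds both for $w_t=1$ and for $w_t=|B_t|$ (for all $t\in\mathcal K$). -/

import Mathlib

open MeasureTheory ProbabilityTheory
open scoped Matrix

namespace SKQAOA

noncomputable section

/-! ### The Sherrington-Kirkpatrick model and QAOA on `n` qubits -/

/-- Computational basis labels of `n` qubits (`true` stands for the bit 1). -/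
abbrev Basis (n : ℕ) : Type := Fin n → Bool

/-- `(-1) ^ b`. -/
def sign (b : Bool) : ℝ := if b then -1 else 1

/-- The Pauli operator `X_k`. -/
def pauliX {n : ℕ} (k : Fin n) : Matrix (Basis n) (Basis n) ℂ :=
  Matrix.of fun x y => if x = Function.update y k (!(y k)) then 1 else 0

/-- The Pauli operator `Z_k`. -/
def pauliZ {n : ℕ} (k : Fin n) : Matrix (Basis n) (Basis n) ℂ :=
  Matrix.diagonal fun x => (sign (x k) : ℂ)

/-- Unordered pairs of distinct spins, written increasingly. -/
abbrev Pairs (n : ℕ) : Type := {e : Fin n × Fin n // e.1 < e.2}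

/-- The law `SK(n)` of the couplings: independent centred Gaussians of variance `1 / n`. -/
def skMeasure (n : ℕ) : Measure (Pairs n → ℝ) :=
  Measure.pi fun _ => gaussianReal 0 (n : NNReal)⁻¹

/-- The problem Hamiltonian `H[J] = ∑_{k < l} J_{kl} Z_k Z_l`. -/
def hamiltonian {n : ℕ} (J : Pairs n → ℝ) : Matrix (Basis n) (Basis n) ℂ :=
  ∑ e : Pairs n, (J e : ℂ) • (pauliZ e.1.1 * pauliZ e.1.2)

/-- The mixer Hamiltonian `H_B = ∑_k X_k`. -/
def mixer (n : ℕ) : Matrix (Basis n) (Basis n) ℂ := ∑ k : Fin n, pauliX k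

/-- The state `|+⟩^{⊗ n}`. -/
def plusState (n : ℕ) : Basis n → ℂ := fun _ => ((1 / Real.sqrt 2 : ℝ) : ℂ) ^ n

/-- One QAOA layer `e^{-i (b/2) H_B} e^{-i (g/2) H[J]}` applied to `ψ`. -/
def qaoaLayer {n : ℕ} (J : Pairs n → ℝ) (b g : ℝ) (ψ : Basis n → ℂ) : Basis n → ℂ :=
  NormedSpace.exp ((-Complex.I * ((b / 2 : ℝ) : ℂ)) • mixer n) *ᵥ
    (NormedSpace.exp ((-Complex.I * ((g / 2 : ℝ) : ℂ)) • hamiltonian J) *ᵥ ψ)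

/-- The level-`p` QAOA state; the layer with index `0` is applied first. -/
def qaoaState {n p : ℕ} (J : Pairs n → ℝ) (β γ : Fin p → ℝ) : Basis n → ℂ :=
  (List.finRange p).foldl (fun ψ j => qaoaLayer J (β j) (γ j) ψ) (plusState n)

/-- The energy per spin `⟨Ψ| H[J] / n |Ψ⟩` of the QAOA state. -/
def qaoaEnergyPerSpin {n p : ℕ} (β γ : Fin p → ℝ) (J : Pairs n → ℝ) : ℂ :=
  star (qaoaState J β γ) ⬝ᵥ (((n : ℂ)⁻¹ • hamiltonian J) *ᵥ qaoaState J β γ)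

/-! ### Bitstrings of length `2 p + 1` -/

/-- Bitstrings `s = s_0 s_1 … s_{2p}`. -/
abbrev Bits (p : ℕ) : Type := Fin (2 * p + 1) → Bool

/-- The bitwise XOR `s ⊕ t`. -/
def bxor {p : ℕ} (s t : Bits p) : Bits p := fun i => xor (s i) (t i)

/-- The central bit `s_p`. -/
def center {p : ℕ} (s : Bits p) : Bool := s ⟨p, by omega⟩

/-- The level of symmetry: the largest `j ≤ p` with `s_{p + k} = s_{p - k}` for all `k ≤ j`. -/
def level {p : ℕ} (s : Bits p) : ℕ :=
  Nat.findGreatest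
    (fun j => ∀ k : Fin (p + 1), (k : ℕ) ≤ j →
      s ⟨p + k, by omega⟩ = s ⟨p - k, by omega⟩) p

/-- `s` is odd when `s_0 ≠ s_p`. -/
def IsOdd {p : ℕ} (s : Bits p) : Prop := s 0 ≠ center s

instance {p : ℕ} (s : Bits p) : Decidable (IsOdd s) := by
  unfold IsOdd; infer_instance

/-- `(-1) ^ 1_{s odd}`. -/
def oddSign {p : ℕ} (s : Bits p) : ℝ := if IsOdd s then -1 else 1

/-- The partial flip `F(s)`: the bits `p - L(s), …, p + L(s)` are negated. -/
def flip {p : ℕ} (s : Bits p) : Bits p := fun i =>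
  if p - level s ≤ (i : ℕ) ∧ (i : ℕ) ≤ p + level s then !(s i) else s i

/-- One mixer factor: `cos (b / 2)` if the two bits agree, `i sin (b / 2)` otherwise. -/
def mixFactor (b : ℝ) (x y : Bool) : ℂ :=
  if x = y then (Real.cos (b / 2) : ℂ) else Complex.I * (Real.sin (b / 2) : ℂ)

/-- `B_{β, s}`. -/
def bCoeff {p : ℕ} (β : Fin p → ℝ) (s : Bits p) : ℂ :=
  ∏ j : Fin p,
    mixFactor (β j) (s ⟨j, by omega⟩) (s ⟨j + 1, by omega⟩) *
      mixFactor (β j) (s ⟨2 * p - j, by omega⟩) (s ⟨2 * p - j - 1, by omega⟩)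

/-- `φ(γ, s) = ∑_j (γ_j / 2) ((-1)^{s_{2p - j}} - (-1)^{s_j})`. -/
def phase {p : ℕ} (γ : Fin p → ℝ) (s : Bits p) : ℝ :=
  ∑ j : Fin p, γ j / 2 * (sign (s ⟨2 * p - j, by omega⟩) - sign (s ⟨j, by omega⟩))

/-- `C_{γ, s} = exp (-φ(γ, s)² / (2 n))`. -/
def damp {p : ℕ} (n : ℕ) (γ : Fin p → ℝ) (s : Bits p) : ℝ :=
  Real.exp (-(phase γ s) ^ 2 / (2 * n))

/-- `l` enumerates, without repetition and by non-decreasing level of symmetry, the odd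
bitstrings of level `< p`. -/
structure IsOddList {p : ℕ} (l : List (Bits p)) : Prop where
  nodup : l.Nodup
  mem_iff : ∀ s, s ∈ l ↔ IsOdd s ∧ level s < p
  sorted : l.Pairwise fun s t => level s ≤ level t

/-! ### The sampling algorithm -/

/-- The intensity `λ` of the string `u`, when the strings in `done` precede `u` and have received
the counts `m`. -/
def intensity {p : ℕ} (n : ℕ) (β γ : Fin p → ℝ) (s t : Bits p) (done : List (Bits p))
    (m : Bits p → ℕ) (u : Bits p) : ℂ :=
  (n : ℂ) * bCoeff β u / 2 *
    ((-(damp n γ (bxor s u) * damp n γ (bxor t u) *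
          (done.map fun v => damp n γ (bxor v u) ^ m v).prod) +
        damp n γ (bxor s (flip u)) * damp n γ (bxor t (flip u)) *
          (done.map fun v => damp n γ (bxor v (flip u)) ^ m v).prod : ℝ) : ℂ)

/-- The loop over the list of odd strings: starting from counts `m` and weight `M`, with the strings
in `done` already treated, go through the remaining strings `u`, drawing
`m_u ∼ Poisson(|λ|)` and multiplying the weight by `e^{|λ|} (λ / |λ|)^{m_u}` whenever `λ ≠ 0`. -/
def drawLoop {p : ℕ} (n : ℕ) (β γ : Fin p → ℝ) (s t : Bits p) :
    List (Bits p) → List (Bits p) → (Bits p → ℕ) → ℂ → PMF ((Bits p → ℕ) × ℂ)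
  | _, [], m, M => PMF.pure (m, M)
  | done, u :: us, m, M =>
    let lam := intensity n β γ s t done m u
    if lam = 0 then drawLoop n β γ s t (done ++ [u]) us m M
    else
      (poissonMeasure ‖lam‖₊).toPMF.bind fun k =>
        drawLoop n β γ s t (done ++ [u]) us (Function.update m u k)
          (M * (Real.exp ‖lam‖ : ℂ) * (lam / (‖lam‖ : ℂ)) ^ k)

/-- The factor by which the weight is multiplied after the loop. With `k = ∑_v m_v`, the
coefficient is `n! / ((n - k - 2)! n^{k + 2})`, which is `0` if `k + 2 > n`, so that the
truncated exponent in the last line plays no role then. -/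
def finalFactor {p : ℕ} (n : ℕ) (β γ : Fin p → ℝ) (s t : Bits p) (l : List (Bits p))
    (m : Bits p → ℕ) : ℂ :=
  let k := (l.map m).sum
  (n.descFactorial (k + 2) : ℂ) / (n : ℂ) ^ (k + 2) * (damp n γ (bxor s t) : ℂ) *
    (1 / 2 * ∑ u : Bits p with level u = p,
      (oddSign u : ℂ) * bCoeff β u *
        ((damp n γ (bxor s u) * damp n γ (bxor t u) *
          (l.map fun v => damp n γ (bxor u v) ^ m v).prod : ℝ) : ℂ)) ^ (n - k - 2)

/-- The law of the random weight `M_{s, t}`. The counts start at `0`, the weight at `1`. -/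
def weightLaw {p : ℕ} (n : ℕ) (β γ : Fin p → ℝ) (l : List (Bits p)) (s t : Bits p) : PMF ℂ :=
  (drawLoop n β γ s t [] l (fun _ => 0) 1).map fun r => r.2 * finalFactor n β γ s t l r.1

/-- The energy sample `E` computed from the weights `M_{s, t}`. -/
def energyOfWeights {p : ℕ} (β γ : Fin p → ℝ) (M : Bits p × Bits p → ℂ) : ℝ :=
  (Complex.I / 8 * ∑ s : Bits p, ∑ t : Bits p,
    (sign (center s) * sign (center t) : ℂ) * bCoeff β s * bCoeff β t *
      (oddSign s : ℂ) * (oddSign t : ℂ) * (phase γ (bxor s t) : ℂ) * M (s, t)).re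

/-- The law of the output of the sampling algorithm: the weights `M_{s, t}` are drawn independently
for all ordered pairs `(s, t)` and combined. -/
def energySampleLaw {p : ℕ} (n : ℕ) (β γ : Fin p → ℝ) (l : List (Bits p)) : Measure ℝ :=
  (Measure.pi fun st : Bits p × Bits p => (weightLaw n β γ l st.1 st.2).toMeasure).map
    (energyOfWeights β γ)

/-! ### The algorithm bounding the variance -/

/-- `|φ(γ, s ⊕ t)² - φ(γ, s ⊕ F(t))²|`. -/
def phaseGap {p : ℕ} (γ : Fin p → ℝ) (s t : Bits p) : ℝ :=
  |phase γ (bxor s t) ^ 2 - phase γ (bxor s (flip t)) ^ 2|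

/-- The assignment `R_s, R_{F(s)} ← x`. -/
def assignPair {p : ℕ} (R : Bits p → ℝ) (s : Bits p) (x : ℝ) : Bits p → ℝ :=
  Function.update (Function.update R s x) (flip s) x

/-- First loop: `R_s = 1` at level `p`, and for `s` in the list
`R_s, R_{F(s)} ← exp (¼ ∑_{t odd, L(t) < p} w_t |φ(γ, s ⊕ t)² - φ(γ, s ⊕ F(t))²|)`. -/
def rHatInit {p : ℕ} (w : Bits p → ℝ) (γ : Fin p → ℝ) (l : List (Bits p)) : Bits p → ℝ :=
  l.foldl (fun R s => assignPair R s
    (Real.exp (1 / 4 * ∑ t : Bits p with IsOdd t ∧ level t < p, w t * phaseGap γ s t)))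
    (fun _ => 1)

/-- Second loop, over the list of odd strings backwards: the argument is the reversed list, so that
`ts` consists of the strings `t < s`, and each of them is updated by
`R_t, R_{F(t)} ← R_t exp (¼ R_s |B_{β, s}| |φ(γ, t ⊕ s)² - φ(γ, t ⊕ F(s))²|)`. -/
def rHatLoop {p : ℕ} (β γ : Fin p → ℝ) : List (Bits p) → (Bits p → ℝ) → (Bits p → ℝ)
  | [], R => R
  | s :: ts, R =>
    rHatLoop β γ ts
      (ts.foldr (fun t R' => assignPair R' t
        (R' t * Real.exp (1 / 4 * R' s * ‖bCoeff β s‖ * phaseGap γ t s))) R)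

/-- The quantities `R̂_s`. -/
def rHat {p : ℕ} (w : Bits p → ℝ) (β γ : Fin p → ℝ) (l : List (Bits p)) : Bits p → ℝ :=
  rHatLoop β γ l.reverse (rHatInit w γ l)

/-- The output `⅛ ∑_{s, t} |φ(γ, s ⊕ t)|² |B_{β, s}| R̂_s |B_{β, t}| R̂_t`. -/
def varianceBound {p : ℕ} (w : Bits p → ℝ) (β γ : Fin p → ℝ) (l : List (Bits p)) : ℝ :=
  1 / 8 * ∑ s : Bits p, ∑ t : Bits p,
    |phase γ (bxor s t)| ^ 2 * ‖bCoeff β s‖ * rHat w β γ l s * ‖bCoeff β t‖ * rHat w β γ l t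

end

end SKQAOA

/-! Inserting basis states around every layer writes the QAOA energy as a sum over families of
bitstrings, one per qubit: a string lists the ket path of the qubit, its final value, and its bra
path backwards. The mixers give a factor ε_s B_s per qubit; the couplings enter through exp(i J_kl
φ(u_k ⊕ u_l)). The Gaussian average turns these exponentials into pair interactions C and the
measured J_kl into iφ/n. All pairs of qubits contribute alike, so fixing the strings s, t of one
pair leaves a partition sum over the other n - 2 qubits (`integral_qaoaEnergyPerSpin_eq`).

This sum is evaluated by eliminating the pairs {u, F(u)} in order of non-decreasing L. If L(u) ≤
L(x), then u and F(u) interact equally with x (`phase_bxor_flip_left`), so only the number k of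
qubits carrying u or F(u) matters (`interactionSum_insert_pair`). On such a pair B agrees and ε
changes sign, so the summed weight is a difference, namely 2λ/n, and together with the falling
factorial the binomial coefficient becomes λ^k / k! (`loopMean_eq`). A Poisson(|λ|) count weighted
by e^{|λ|} (λ/|λ|)^k has exactly this mean (`mean_drawLoop`). Strings with L = p do not interact
with each other and sum to a power.

For the variance, the squared weight e^{2|λ|} and the Poisson generating function combine to
e^{|λ|(1 + g)}, where g bounds the amplification of one copy of u by the later strings. As |λ| is at
most linear in the earlier counts (`norm_intensity_le`), a bound of product form propagates
backwards along the list (`tsum_drawLoop_sq_le`). The output R̂ of the bounding algorithm dominates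
these amplifications (`growth_le_rHat`), hence E|M_{s,t}|² ≤ R̂_s R̂_t, and the variances add by
independence (`variance_energySampleLaw_le`). -/

namespace SKQAOA

/-! ### Combinatorics of the bitstrings -/

section Bitstrings

variable {p : ℕ}

theorem level_le (s : Bits p) : level s ≤ p := Nat.findGreatest_le _

theorem mirror_of_le_level (s : Bits p) {k : ℕ} (hk : k ≤ level s) :
    s ⟨p + k, by have := level_le s; omega⟩ = s ⟨p - k, by omega⟩ := by
  have h := Nat.findGreatest_spec (P := fun j => ∀ k : Fin (p + 1), (k : ℕ) ≤ j →
      s ⟨p + k, by omega⟩ = s ⟨p - k, by omega⟩) (Nat.zero_le p) (by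
    intro k hk
    have : (k : ℕ) = 0 := by omega
    simp [this])
  have := level_le s
  exact h ⟨k, by omega⟩ hk

theorem mirror_ne_of_level_lt (s : Bits p) (h : level s < p) :
    s ⟨p + (level s + 1), by omega⟩ ≠ s ⟨p - (level s + 1), by omega⟩ := by
  intro heq
  have := Nat.findGreatest_is_greatest (P := fun j => ∀ k : Fin (p + 1), (k : ℕ) ≤ j →
      s ⟨p + k, by omega⟩ = s ⟨p - k, by omega⟩) (n := p) (k := level s + 1)
      (Nat.lt_succ_self _) h
  apply this
  intro k hk
  rcases Nat.lt_or_ge k (level s + 1) with h1 | h1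
  · exact mirror_of_le_level s (by omega)
  · have h2 : (k : ℕ) = level s + 1 := by omega
    simp only [h2]
    exact heq

theorem level_eq_of_mirror (s : Bits p) {r : ℕ} (hr : r ≤ p)
    (h1 : ∀ k, (hk : k ≤ r) → s ⟨p + k, by omega⟩ = s ⟨p - k, by omega⟩)
    (h2 : (h : r < p) → s ⟨p + (r + 1), by omega⟩ ≠ s ⟨p - (r + 1), by omega⟩) :
    level s = r := by
  have hle := level_le s
  rcases lt_trichotomy (level s) r with h | h | h
  · exact absurd (h1 (level s + 1) (by omega)) (mirror_ne_of_level_lt s (by omega))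
  · exact h
  · exact absurd (mirror_of_le_level s (k := r + 1) (by omega)) (h2 (by omega))

theorem flip_apply_of_le (s : Bits p) {i : ℕ} (hi : i < 2 * p + 1)
    (h1 : p ≤ i + level s) (h2 : i ≤ p + level s) : flip s ⟨i, hi⟩ = !(s ⟨i, hi⟩) := by
  have : p - level s ≤ i ∧ i ≤ p + level s := by omega
  simp [flip, this]

theorem flip_apply_of_not_le (s : Bits p) {i : ℕ} (hi : i < 2 * p + 1)
    (h : i + level s < p ∨ p + level s < i) : flip s ⟨i, hi⟩ = s ⟨i, hi⟩ := by
  have : ¬ (p - level s ≤ i ∧ i ≤ p + level s) := by omega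
  simp only [flip, if_neg this]

theorem level_flip (s : Bits p) : level (flip s) = level s := by
  have hle := level_le s
  apply level_eq_of_mirror _ hle
  · intro k hk
    rw [flip_apply_of_le s _ (by omega) (by omega), flip_apply_of_le s _ (by omega) (by omega),
      mirror_of_le_level s hk]
  · intro h
    rw [flip_apply_of_not_le s _ (by omega), flip_apply_of_not_le s _ (by omega)]
    exact mirror_ne_of_level_lt s h

theorem flip_flip (s : Bits p) : flip (flip s) = s := by
  funext i
  by_cases h : p - level s ≤ (i : ℕ) ∧ (i : ℕ) ≤ p + level s
  · simp only [flip, level_flip, if_pos h, Bool.not_not]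
  · simp only [flip, level_flip, if_neg h]

theorem isOdd_flip (s : Bits p) (h : level s < p) : IsOdd (flip s) ↔ ¬ IsOdd s := by
  have h0 : flip s 0 = s 0 := flip_apply_of_not_le s (i := 0) (by omega) (by omega)
  have h1 : center (flip s) = !(center s) := flip_apply_of_le s _ (by omega) (by omega)
  unfold IsOdd
  rw [h0, h1]
  cases s 0 <;> cases center s <;> simp

theorem oddSign_flip (s : Bits p) (h : level s < p) : oddSign (flip s) = -oddSign s := by
  unfold oddSign
  have := isOdd_flip s h
  by_cases h1 : IsOdd s <;> simp [this, h1]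

theorem norm_mixFactor_le_one (b : ℝ) (x y : Bool) : ‖mixFactor b x y‖ ≤ 1 := by
  unfold mixFactor
  split_ifs
  · rw [Complex.norm_real]; exact Real.abs_cos_le_one _
  · rw [norm_mul, Complex.norm_I, one_mul, Complex.norm_real]; exact Real.abs_sin_le_one _

theorem norm_bCoeff_le_one (β : Fin p → ℝ) (s : Bits p) : ‖bCoeff β s‖ ≤ 1 := by
  unfold bCoeff
  rw [norm_prod]
  apply Finset.prod_le_one
  · intros; positivity
  · intros
    rw [norm_mul]
    exact mul_le_one₀ (norm_mixFactor_le_one _ _ _) (norm_nonneg _) (norm_mixFactor_le_one _ _ _)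

/-- At the edge of the flipped window the inner mirror bits agree and the outer ones differ, so one
factor is a cosine and the other a sine; negating the inner bits merely exchanges them. -/
theorem mixFactor_swap (b : ℝ) {x x' y y' : Bool} (h : x' ≠ x) (h' : y' = y) :
    mixFactor b x (!y) * mixFactor b x' (!y') = mixFactor b x y * mixFactor b x' y' := by
  subst h'
  cases x <;> cases x' <;> cases y' <;> simp [mixFactor, mul_comm] at *

theorem mixFactor_not_not (b : ℝ) (x y : Bool) : mixFactor b (!x) (!y) = mixFactor b x y := by
  cases x <;> cases y <;> simp [mixFactor]

/-- A link with both ends inside the flipped window, or both outside, is unaffected; the two mirror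
links across the edge are handled by `mixFactor_swap`. -/
theorem bCoeff_flip (β : Fin p → ℝ) (s : Bits p) (h : level s < p) :
    bCoeff β (flip s) = bCoeff β s := by
  unfold bCoeff
  refine Finset.prod_congr rfl fun j _ => ?_
  have hj := j.2
  have hidx : (⟨2 * p - j - 1, by omega⟩ : Fin (2 * p + 1)) = ⟨2 * p - (j + 1), by omega⟩ := by
    ext; simp only; omega
  rw [hidx]
  rcases lt_trichotomy (p - (j : ℕ)) (level s + 1) with h1 | h1 | h1
  · rw [flip_apply_of_le s _ (by omega) (by omega), flip_apply_of_le s _ (by omega) (by omega),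
      flip_apply_of_le s _ (by omega) (by omega), flip_apply_of_le s _ (by omega) (by omega),
      mixFactor_not_not, mixFactor_not_not]
  · rw [flip_apply_of_not_le s _ (by omega), flip_apply_of_le s _ (by omega) (by omega),
      flip_apply_of_not_le s _ (by omega), flip_apply_of_le s _ (by omega) (by omega)]
    apply mixFactor_swap
    · have := mirror_ne_of_level_lt s h
      convert this using 3 <;> omega
    · have := mirror_of_le_level s (k := level s) le_rfl
      convert this using 3 <;> omega
  · rw [flip_apply_of_not_le s _ (by omega), flip_apply_of_not_le s _ (by omega),
      flip_apply_of_not_le s _ (by omega), flip_apply_of_not_le s _ (by omega)]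

theorem bxor_comm (s t : Bits p) : bxor s t = bxor t s := by
  funext i; simp [bxor, Bool.xor_comm]

/-- Within the flipped window both strings are palindromic, so the mirror terms of φ cancel before
and after the flip. The central bit does not occur in φ. -/
theorem phase_bxor_flip_left (γ : Fin p → ℝ) {s t : Bits p} (h : level s ≤ level t) :
    phase γ (bxor (flip s) t) = phase γ (bxor s t) := by
  unfold phase
  refine Finset.sum_congr rfl fun j _ => ?_
  have hj := j.2
  by_cases hd : p - (j : ℕ) ≤ level s
  · have e1 : (⟨2 * p - j, by omega⟩ : Fin (2 * p + 1)) = ⟨p + (p - j), by omega⟩ := by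
      ext; simp only; omega
    have e2 : (⟨j, by omega⟩ : Fin (2 * p + 1)) = ⟨p - (p - j), by omega⟩ := by
      ext; simp only; omega
    have hs := mirror_of_le_level s hd
    have ht := mirror_of_le_level t (hd.trans h)
    simp only [bxor]
    rw [e1, e2, flip_apply_of_le s _ (by omega) (by omega),
      flip_apply_of_le s _ (by omega) (by omega), hs, ht]
    simp
  · simp only [bxor]
    rw [flip_apply_of_not_le s _ (by omega), flip_apply_of_not_le s _ (by omega)]

theorem phase_bxor_flip_right (γ : Fin p → ℝ) {s t : Bits p} (h : level t ≤ level s) :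
    phase γ (bxor s (flip t)) = phase γ (bxor s t) := by
  rw [bxor_comm s, phase_bxor_flip_left γ h, bxor_comm]

theorem phase_bxor_eq_zero (γ : Fin p → ℝ) {s t : Bits p}
    (hs : level s = p) (ht : level t = p) : phase γ (bxor s t) = 0 := by
  unfold phase
  refine Finset.sum_eq_zero fun j _ => ?_
  have e1 : (⟨2 * p - j, by omega⟩ : Fin (2 * p + 1)) = ⟨p + (p - j), by omega⟩ := by
    ext; simp only; omega
  have e2 : (⟨j, by omega⟩ : Fin (2 * p + 1)) = ⟨p - (p - j), by omega⟩ := by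
    ext; simp only; omega
  simp only [bxor]
  rw [e1, e2, mirror_of_le_level s (by omega), mirror_of_le_level t (by omega)]
  simp

theorem phase_bxor_self (γ : Fin p → ℝ) (s : Bits p) : phase γ (bxor s s) = 0 := by
  simp [phase, bxor]

theorem damp_bxor_comm (n : ℕ) (γ : Fin p → ℝ) (s t : Bits p) :
    damp n γ (bxor s t) = damp n γ (bxor t s) := by rw [bxor_comm]

theorem damp_bxor_flip_left (n : ℕ) (γ : Fin p → ℝ) {s t : Bits p} (h : level s ≤ level t) :
    damp n γ (bxor (flip s) t) = damp n γ (bxor s t) := by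
  rw [damp, phase_bxor_flip_left γ h, damp]

theorem damp_bxor_flip_right (n : ℕ) (γ : Fin p → ℝ) {s t : Bits p} (h : level t ≤ level s) :
    damp n γ (bxor s (flip t)) = damp n γ (bxor s t) := by
  rw [damp, phase_bxor_flip_right γ h, damp]

theorem damp_bxor_eq_one (n : ℕ) (γ : Fin p → ℝ) {s t : Bits p}
    (hs : level s = p) (ht : level t = p) : damp n γ (bxor s t) = 1 := by
  simp [damp, phase_bxor_eq_zero γ hs ht]

theorem damp_bxor_self (n : ℕ) (γ : Fin p → ℝ) (s : Bits p) : damp n γ (bxor s s) = 1 := by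
  simp [damp, phase_bxor_self]

theorem damp_nonneg (n : ℕ) (γ : Fin p → ℝ) (s : Bits p) : 0 ≤ damp n γ s := (Real.exp_pos _).le

theorem damp_le_one (n : ℕ) (γ : Fin p → ℝ) (s : Bits p) : damp n γ s ≤ 1 := by
  unfold damp
  rw [Real.exp_le_one_iff]
  have : 0 ≤ (phase γ s) ^ 2 / (2 * n) := by positivity
  rw [neg_div]; linarith

theorem phaseGap_nonneg (γ : Fin p → ℝ) (s t : Bits p) : 0 ≤ phaseGap γ s t := abs_nonneg _

/-- A string can thus amplify only strings of strictly lower level, which makes the second-moment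
recursion triangular along the enumeration. -/
theorem phaseGap_eq_zero (γ : Fin p → ℝ) {s t : Bits p} (h : level t ≤ level s) :
    phaseGap γ s t = 0 := by
  simp [phaseGap, phase_bxor_flip_right γ h]

theorem phaseGap_flip_left (γ : Fin p → ℝ) (s t : Bits p) :
    phaseGap γ (flip s) t = phaseGap γ s t := by
  rcases le_total (level t) (level s) with h | h
  · rw [phaseGap_eq_zero γ h, phaseGap_eq_zero γ (by rwa [level_flip])]
  · unfold phaseGap
    rw [phase_bxor_flip_left γ h, phase_bxor_flip_left γ (by rwa [level_flip])]

/-- The total weight of the paths of a stochastic chain on two states, over both initial states. -/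
theorem sum_path_prod (p : ℕ) (w : Fin p → Bool → Bool → ℝ)
    (hw : ∀ j x, ∑ y, w j x y = 1) :
    ∑ h : Fin (p + 1) → Bool, ∏ j : Fin p, w j (h j.castSucc) (h j.succ) = 2 := by
  induction p with
  | zero => simp
  | succ p ih =>
    rw [← (Fin.snocEquiv fun _ : Fin (p + 2) => Bool).sum_comp, Fintype.sum_prod_type_right]
    rw [← ih (fun j => w j.castSucc) (fun j => hw _)]
    refine Finset.sum_congr rfl fun h _ => ?_
    have : ∀ x : Bool, (∏ j : Fin (p + 1), w j ((Fin.snoc h x : Fin (p + 2) → Bool) j.castSucc)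
        ((Fin.snoc h x : Fin (p + 2) → Bool) j.succ)) =
        (∏ j : Fin p, w j.castSucc (h j.castSucc) (h j.succ)) *
          w (Fin.last p) (h (Fin.last p)) x := by
      intro x
      rw [Fin.prod_univ_castSucc]
      congr 1
      · refine Finset.prod_congr rfl fun j _ => ?_
        rw [Fin.snoc_castSucc, Fin.succ_castSucc, Fin.snoc_castSucc]
      · rw [Fin.snoc_castSucc, Fin.succ_last, Fin.snoc_last]
    simp only [Fin.snocEquiv, Equiv.coe_fn_mk]
    rw [Finset.sum_congr rfl fun x _ => this x, ← Finset.mul_sum, hw, mul_one]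

/-- A palindrome is determined by its first p + 1 bits, and its mirror factors pair up to cos² or
sin², the transition probabilities of a chain on two states. The 2 counts the initial states, and
cancels the 1/2 in `finalFactor`. -/
theorem sum_norm_bCoeff_le (β : Fin p → ℝ) :
    ∑ u : Bits p with level u = p, ‖bCoeff β u‖ ≤ 2 := by
  classical
  set w : Fin p → Bool → Bool → ℝ := fun j x y => ‖mixFactor (β j) x y‖ ^ 2 with hw
  have hsum : ∀ j x, ∑ y, w j x y = 1 := by
    intro j x
    have : |Real.cos (β j / 2)| ^ 2 + |Real.sin (β j / 2)| ^ 2 = 1 := by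
      rw [sq_abs, sq_abs, Real.cos_sq_add_sin_sq]
    cases x <;> simp [hw, mixFactor, -Complex.ofReal_cos, -Complex.ofReal_sin]
  rw [← sum_path_prod p w hsum]
  let r : Bits p → (Fin (p + 1) → Bool) := fun u i => u ⟨i, by omega⟩
  have hinj : Set.InjOn r (Finset.univ.filter fun u : Bits p => level u = p) := by
    intro u hu v hv huv
    simp only [Finset.coe_filter, Finset.mem_univ, true_and, Set.mem_ofPred_eq] at hu hv
    funext i
    by_cases hi : (i : ℕ) ≤ p
    · exact congrFun huv ⟨i, by omega⟩
    · have e : i = ⟨p + (i - p), by omega⟩ := by ext; simp only; omega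
      rw [e, mirror_of_le_level u (by omega), mirror_of_le_level v (by omega)]
      exact congrFun huv ⟨p - (i - p), by omega⟩
  calc ∑ u : Bits p with level u = p, ‖bCoeff β u‖
      = ∑ u : Bits p with level u = p,
          ∏ j : Fin p, w j (r u j.castSucc) (r u j.succ) := by
        refine Finset.sum_congr rfl fun u hu => ?_
        simp only [Finset.mem_filter, Finset.mem_univ, true_and] at hu
        rw [bCoeff, norm_prod]
        refine Finset.prod_congr rfl fun j _ => ?_
        have h1 : u ⟨2 * p - j, by omega⟩ = u ⟨j, by omega⟩ := by
          have := mirror_of_le_level u (k := p - j) (by omega)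
          convert this using 3 <;> omega
        have h2 : u ⟨2 * p - j - 1, by omega⟩ = u ⟨j + 1, by omega⟩ := by
          have := mirror_of_le_level u (k := p - j - 1) (by omega)
          convert this using 3 <;> omega
        rw [norm_mul, h1, h2]
        simp [hw, r, sq]
    _ = ∑ h ∈ (Finset.univ.filter fun u : Bits p => level u = p).image r,
          ∏ j : Fin p, w j (h j.castSucc) (h j.succ) :=
        (Finset.sum_image (f := fun h : Fin (p + 1) → Bool =>
          ∏ j : Fin p, w j (h j.castSucc) (h j.succ)) hinj).symm
    _ ≤ _ := Finset.sum_le_sum_of_subset_of_nonneg (Finset.subset_univ _)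
        fun _ _ _ => Finset.prod_nonneg fun _ _ => by positivity

end Bitstrings

noncomputable section

/-! ### Partition sums with pair interactions -/

section InteractionSum

variable {α : Type*}

/-- The sum over all sequences `x_1, …, x_N` in `A` of `∏_i a (x_i) ∏_{i < j} c (x_i) (x_j)`. -/
def interactionSum (c : α → α → ℂ) (A : Finset α) : ℕ → (α → ℂ) → ℂ
  | 0, _ => 1
  | N + 1, a => ∑ x ∈ A, a x * interactionSum c A N fun y => a y * c x y

theorem interactionSum_congr (c : α → α → ℂ) (A : Finset α) (N : ℕ) {a b : α → ℂ}
    (h : ∀ x ∈ A, a x = b x) : interactionSum c A N a = interactionSum c A N b := by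
  induction N generalizing a b with
  | zero => rfl
  | succ N ih =>
    refine Finset.sum_congr rfl fun x hx => ?_
    rw [h x hx, ih fun y hy => ?_]
    rw [h y hy]

theorem interactionSum_of_free (c : α → α → ℂ) (A : Finset α) (N : ℕ) (a : α → ℂ)
    (h : ∀ x ∈ A, ∀ y ∈ A, c x y = 1) : interactionSum c A N a = (∑ x ∈ A, a x) ^ N := by
  induction N with
  | zero => simp [interactionSum]
  | succ N ih =>
    rw [interactionSum, pow_succ', Finset.sum_mul]
    refine Finset.sum_congr rfl fun x hx => ?_
    rw [← ih, interactionSum_congr c A N fun y hy => ?_]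
    rw [h x hx y hy, mul_one]

/-- Two letters that act identically on everything, and trivially on themselves and each other, can
be counted together: k is the number of sites occupied by either, and binomially many placements are
equivalent. -/
theorem interactionSum_insert_pair [DecidableEq α] (c : α → α → ℂ) (A : Finset α) {u v : α}
    (hu : u ∉ insert v A) (hv : v ∉ A) (huu : c u u = 1) (huv : c u v = 1) (hvu : c v u = 1)
    (hvv : c v v = 1) (hvA : ∀ y ∈ A, c v y = c u y) (hAu : ∀ y ∈ A, c y u = c u y)
    (hAv : ∀ y ∈ A, c y v = c u y) (N : ℕ) (a : α → ℂ) :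
    interactionSum c (insert u (insert v A)) N a =
      ∑ k ∈ Finset.range (N + 1), (N.choose k : ℂ) *
        ((a u + a v) ^ k * interactionSum c A (N - k) fun y => a y * c u y ^ k) := by
  induction N generalizing a with
  | zero => simp [interactionSum]
  | succ N ih =>
    rw [interactionSum, Finset.sum_insert hu, Finset.sum_insert hv]
    have hcongr : interactionSum c (insert u (insert v A)) N (fun y => a y * c v y) =
        interactionSum c (insert u (insert v A)) N (fun y => a y * c u y) := by
      refine interactionSum_congr _ _ _ fun y hy => ?_
      rcases Finset.mem_insert.1 hy with rfl | hy
      · rw [huu, hvu]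
      rcases Finset.mem_insert.1 hy with rfl | hy
      · rw [hvv, huv]
      · rw [hvA y hy]
    -- The first site holds u or v: the induction hypothesis applies with k shifted by one.
    have h1 : a u * interactionSum c (insert u (insert v A)) N (fun y => a y * c u y) +
        a v * interactionSum c (insert u (insert v A)) N (fun y => a y * c v y) =
        ∑ k ∈ Finset.range (N + 1), (N.choose k : ℂ) *
          ((a u + a v) ^ (k + 1) *
            interactionSum c A (N + 1 - (k + 1)) fun y => a y * c u y ^ (k + 1)) := by
      rw [hcongr, ← add_mul, ih, Finset.mul_sum]
      refine Finset.sum_congr rfl fun k _ => ?_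
      rw [huu, huv, mul_one, mul_one, Nat.add_sub_add_right]
      rw [interactionSum_congr c A (N - k) (b := fun y => a y * c u y ^ (k + 1))
        fun y _ => by ring]
      ring
    -- The first site holds a letter of A, which reassembles an `interactionSum` over A with one
    -- more site.
    have h2 : ∑ x ∈ A, a x * interactionSum c (insert u (insert v A)) N (fun y => a y * c x y) =
        ∑ k ∈ Finset.range (N + 1), (N.choose k : ℂ) *
          ((a u + a v) ^ k * interactionSum c A (N + 1 - k) fun y => a y * c u y ^ k) := by
      simp only [ih, Finset.mul_sum]
      rw [Finset.sum_comm]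
      refine Finset.sum_congr rfl fun k hk => ?_
      have hk' : k ≤ N := by have := Finset.mem_range.1 hk; omega
      rw [Nat.succ_sub hk', interactionSum, Finset.mul_sum, Finset.mul_sum]
      refine Finset.sum_congr rfl fun x hx => ?_
      rw [hAu x hx, hAv x hx, ← add_mul, mul_pow,
        interactionSum_congr c A (N - k) (a := fun y => a y * c x y * c u y ^ k)
          (b := fun y => a y * c u y ^ k * c x y) fun y _ => by ring]
      ring
    -- Pascal's rule merges the two contributions.
    rw [← add_assoc, h1, h2, add_comm]
    rw [Finset.sum_range_succ' (fun k => ((N + 1).choose k : ℂ) *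
        ((a u + a v) ^ k * interactionSum c A (N + 1 - k) fun y => a y * c u y ^ k)) (N + 1)]
    simp only [Nat.choose_succ_succ, Nat.cast_add, add_mul, Finset.sum_add_distrib]
    rw [Finset.sum_range_succ (fun k => ((N.choose (k + 1) : ℕ) : ℂ) * _) N,
      Finset.sum_range_succ' (fun k => (N.choose k : ℂ) *
        ((a u + a v) ^ k * interactionSum c A (N + 1 - k) fun y => a y * c u y ^ k)) N]
    simp
    ring

end InteractionSum

/-! ### The mean of the weights as an interaction sum -/

section LoopMean

variable {p : ℕ}

/-- The strings of level `p`, together with those of `us` and their partial flips. -/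
def flipClosure : List (Bits p) → Finset (Bits p)
  | [] => Finset.univ.filter fun u => level u = p
  | u :: us => insert u (insert (flip u) (flipClosure us))

theorem mem_flipClosure {us : List (Bits p)} {x : Bits p} :
    x ∈ flipClosure us ↔ level x = p ∨ x ∈ us ∨ flip x ∈ us := by
  induction us with
  | nil => simp [flipClosure]
  | cons u us ih =>
    have : x = flip u ↔ flip x = u :=
      ⟨fun h => by rw [h, flip_flip], fun h => by rw [← h, flip_flip]⟩
    simp only [flipClosure, Finset.mem_insert, ih, List.mem_cons, this]
    tauto

/-- Below level p the partial flip exchanges odd and even strings, so each even one is the flip of a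
listed one. -/
theorem flipClosure_eq_univ {l : List (Bits p)} (hl : IsOddList l) :
    flipClosure l = Finset.univ := by
  ext x
  simp only [mem_flipClosure, Finset.mem_univ, iff_true, hl.mem_iff, level_flip]
  rcases (level_le x).lt_or_eq with h | h
  · by_cases ho : IsOdd x
    · exact Or.inr (Or.inl ⟨ho, h⟩)
    · exact Or.inr (Or.inr ⟨(isOdd_flip x h).2 ho, h⟩)
  · exact Or.inl h

/-- The interaction between two strings. -/
def dampC (n : ℕ) (γ : Fin p → ℝ) (x y : Bits p) : ℂ := (damp n γ (bxor x y) : ℂ)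

/-- The weight of the string `x` in the presence of `s`, `t` and of `m_v` copies of each `v` in
`done`. -/
def siteWeight (n : ℕ) (β γ : Fin p → ℝ) (s t : Bits p) (done : List (Bits p)) (m : Bits p → ℕ)
    (x : Bits p) : ℂ :=
  (oddSign x : ℂ) * bCoeff β x * ((damp n γ (bxor s x) * damp n γ (bxor t x) *
    (done.map fun v => damp n γ (bxor x v) ^ m v).prod : ℝ) : ℂ)

/-- The expected final weight, given the counts `m` of the strings that have been treated. -/
def loopMean (n : ℕ) (β γ : Fin p → ℝ) (s t : Bits p) (l : List (Bits p)) :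
    List (Bits p) → List (Bits p) → (Bits p → ℕ) → ℂ
  | _, [], m => finalFactor n β γ s t l m
  | done, u :: us, m => ∑' k : ℕ, intensity n β γ s t done m u ^ k / (k.factorial : ℂ) *
      loopMean n β γ s t l (done ++ [u]) us (Function.update m u k)

/-- The minus sign in λ is the sign ε of the odd string u, against ε = 1 for F(u); the coefficient B
is common to both. -/
theorem intensity_eq (n : ℕ) (β γ : Fin p → ℝ) (s t : Bits p) (done : List (Bits p))
    (m : Bits p → ℕ) {u : Bits p} (hu : IsOdd u) (hlt : level u < p) :
    intensity n β γ s t done m u = (n : ℂ) / 2 *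
      (siteWeight n β γ s t done m u + siteWeight n β γ s t done m (flip u)) := by
  have h1 : oddSign u = -1 := by simp [oddSign, hu]
  have h2 : oddSign (flip u) = 1 := by rw [oddSign_flip u hlt, h1, neg_neg]
  unfold intensity siteWeight
  simp only [bxor_comm u, bxor_comm (flip u), h1, h2, bCoeff_flip β u hlt]
  push_cast
  ring

theorem siteWeight_append_update (n : ℕ) (β γ : Fin p → ℝ) (s t : Bits p) {done : List (Bits p)}
    (m : Bits p → ℕ) {u : Bits p} (hu : u ∉ done) (k : ℕ) (x : Bits p) :
    siteWeight n β γ s t (done ++ [u]) (Function.update m u k) x =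
      siteWeight n β γ s t done m x * dampC n γ u x ^ k := by
  have : (done.map fun v => damp n γ (bxor x v) ^ Function.update m u k v) =
      done.map fun v => damp n γ (bxor x v) ^ m v := by
    refine List.map_congr_left fun v hv => ?_
    rw [Function.update_of_ne (by rintro rfl; exact hu hv)]
  unfold siteWeight dampC
  rw [List.map_append, List.prod_append, this, bxor_comm u x]
  simp
  ring

theorem sum_map_append_update {done : List (Bits p)} (m : Bits p → ℕ) {u : Bits p}
    (hu : u ∉ done) (k : ℕ) :
    ((done ++ [u]).map (Function.update m u k)).sum = (done.map m).sum + k := by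
  have : done.map (Function.update m u k) = done.map m := by
    refine List.map_congr_left fun v hv => ?_
    rw [Function.update_of_ne (by rintro rfl; exact hu hv)]
  rw [List.map_append, List.sum_append, this]
  simp

/-- Each turn of the loop eliminates one pair {u, F(u)} from the partition sum. The prefactor
n!/((n-K-2)! n^{K+2}) absorbs k! and the powers of n and 2 that separate the binomial expansion from
the series of λ^k / k!. -/
theorem loopMean_eq {n : ℕ} (hn : 0 < n) (β γ : Fin p → ℝ) (s t : Bits p) {l : List (Bits p)}
    (hl : IsOddList l) (us done : List (Bits p)) (hdone : done ++ us = l) (m : Bits p → ℕ) :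
    loopMean n β γ s t l done us m =
      (n.descFactorial ((done.map m).sum + 2) : ℂ) / (n : ℂ) ^ ((done.map m).sum + 2) *
        (damp n γ (bxor s t) : ℂ) * ((1 / 2) ^ (n - 2 - (done.map m).sum) *
          interactionSum (dampC n γ) (flipClosure us) (n - 2 - (done.map m).sum)
            (siteWeight n β γ s t done m)) := by
  induction us generalizing done m with
  | nil =>
    rw [List.append_nil] at hdone
    subst hdone
    -- Only strings of level p remain, and they are mutually non-interacting.
    rw [loopMean, finalFactor, interactionSum_of_free, ← mul_pow, Nat.sub_right_comm]
    · rfl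
    · intro x hx y hy
      simp only [flipClosure, Finset.mem_filter, Finset.mem_univ, true_and] at hx hy
      rw [dampC, damp_bxor_eq_one n γ hx hy, Complex.ofReal_one]
  | cons u us ih =>
    have hdone' : (done ++ [u]) ++ us = l := by simpa using hdone
    have hnd : (done ++ u :: us).Nodup := hdone ▸ hl.nodup
    have hsort : (done ++ u :: us).Pairwise fun s t => level s ≤ level t := hdone ▸ hl.sorted
    have hmem : ∀ x ∈ u :: us, IsOdd x ∧ level x < p := fun x hx =>
      (hl.mem_iff x).1 (hdone ▸ List.mem_append_right _ hx)
    obtain ⟨huo, hul⟩ := hmem u List.mem_cons_self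
    have hu_done : u ∉ done := fun h => by
      have := (List.nodup_append.1 hnd).2.2 u h u List.mem_cons_self
      exact this rfl
    have hu_us : u ∉ us := (List.nodup_cons.1 (List.nodup_append.1 hnd).2.1).1
    have hle : ∀ x ∈ us, level u ≤ level x :=
      (List.pairwise_cons.1 (List.pairwise_append.1 hsort).2.1).1
    -- The ordering by level is used here: u is of minimal level among the strings still present, so
    -- u and F(u) are indistinguishable to them.
    have hleA : ∀ x ∈ flipClosure us, level u ≤ level x := by
      intro x hx
      rcases mem_flipClosure.1 hx with h | h | h
      · rw [h]; exact hul.le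
      · exact hle x h
      · rw [← level_flip x]; exact hle _ h
    have hfo : ¬ IsOdd (flip u) := fun h => (isOdd_flip u hul).1 h huo
    have hvA : flip u ∉ flipClosure us := by
      intro h
      rcases mem_flipClosure.1 h with h | h | h
      · rw [level_flip] at h; omega
      · exact hfo (hmem _ (List.mem_cons_of_mem _ h)).1
      · rw [flip_flip] at h; exact hu_us h
    have huA : u ∉ insert (flip u) (flipClosure us) := by
      intro h
      rcases Finset.mem_insert.1 h with h | h
      · exact hfo (h ▸ huo)
      rcases mem_flipClosure.1 h with h | h | h
      · omega
      · exact hu_us h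
      · exact hfo (hmem _ (List.mem_cons_of_mem _ h)).1
    set K := (done.map m).sum with hK
    have hn0 : (n : ℂ) ≠ 0 := by exact_mod_cast hn.ne'
    rw [loopMean, flipClosure, interactionSum_insert_pair (dampC n γ) (flipClosure us) huA hvA]
    rotate_left
    · rw [dampC, damp_bxor_self, Complex.ofReal_one]
    · rw [dampC, damp_bxor_flip_right n γ le_rfl, damp_bxor_self, Complex.ofReal_one]
    · rw [dampC, damp_bxor_flip_left n γ le_rfl, damp_bxor_self, Complex.ofReal_one]
    · rw [dampC, damp_bxor_self, Complex.ofReal_one]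
    · intro y hy
      rw [dampC, damp_bxor_flip_left n γ (hleA y hy), dampC]
    · intro y _
      rw [dampC, damp_bxor_comm, dampC]
    · intro y hy
      rw [dampC, damp_bxor_flip_right n γ (hleA y hy), damp_bxor_comm, dampC]
    -- More copies of u than free qubits contribute nothing, since the falling factorial vanishes;
    -- the truncated subtraction is harmless for the same reason.
    rw [tsum_eq_sum (s := Finset.range (n - 2 - K + 1))]
    · rw [Finset.mul_sum, Finset.mul_sum]
      refine Finset.sum_congr rfl fun k hk => ?_
      have hk' : k ≤ n - 2 - K := by have := Finset.mem_range.1 hk; omega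
      rw [ih _ hdone', sum_map_append_update m hu_done, ← hK,
        intensity_eq n β γ s t done m huo hul,
        interactionSum_congr _ _ _ fun x _ =>
          siteWeight_append_update n β γ s t m hu_done k x]
      have e1 : K + k + 2 = (K + 2) + k := by ring
      have e2 : n - 2 - (K + k) = n - 2 - K - k := by omega
      have e3 : n - (K + 2) = n - 2 - K := by omega
      have hd : n.descFactorial (K + k + 2) =
          n.descFactorial (K + 2) * (k.factorial * (n - 2 - K).choose k) := by
        rw [e1, ← Nat.descFactorial_mul_descFactorial (k := K + 2) (m := K + 2 + k) (by omega),
          Nat.add_sub_cancel_left, e3, Nat.descFactorial_eq_factorial_mul_choose, mul_comm]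
      have e4 : ((1 : ℂ) / 2) ^ (n - 2 - K) = (1 / 2) ^ (n - 2 - K - k) * (1 / 2 ^ k) := by
        rw [← one_div_pow, ← pow_add, Nat.sub_add_cancel hk']
      have hk0 : (k.factorial : ℂ) ≠ 0 := by exact_mod_cast k.factorial_ne_zero
      rw [hd, e2, e4, e1, pow_add, mul_pow, div_pow]
      push_cast
      field_simp
    · intro k hk
      have hk' : n - 2 - K < k := by simpa using hk
      rw [ih _ hdone', sum_map_append_update m hu_done, ← hK,
        Nat.descFactorial_eq_zero_iff_lt.2 (by omega)]
      simp

end LoopMean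

/-! ### Expectations under probability mass functions -/

section PMFExpectation

variable {α β : Type*}

/-- Writing the measure as a weighted sum of Dirac masses works on uncountable carriers such as ℂ,
and without measurability of `g`. -/
theorem lintegral_toMeasure [MeasurableSpace α] [MeasurableSingletonClass α] (P : PMF α)
    (g : α → ENNReal) : ∫⁻ a, g a ∂P.toMeasure = ∑' a, P a * g a := by
  have : P.toMeasure = Measure.sum fun a => P a • Measure.dirac a := by
    ext s hs
    rw [P.toMeasure_apply hs, Measure.sum_apply _ hs]
    refine tsum_congr fun a => ?_
    rw [Measure.smul_apply, Measure.dirac_apply' _ hs]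
    by_cases h : a ∈ s <;> simp [h]
  rw [this, lintegral_sum_measure]
  exact tsum_congr fun a => by rw [lintegral_smul_measure, lintegral_dirac, smul_eq_mul]

theorem tsum_bind_mul (P : PMF α) (f : α → PMF β) (g : β → ENNReal) :
    ∑' b, P.bind f b * g b = ∑' a, P a * ∑' b, f a b * g b := by
  simp only [PMF.bind_apply, ← ENNReal.tsum_mul_right, ← ENNReal.tsum_mul_left]
  rw [ENNReal.tsum_comm]
  simp only [mul_assoc]

theorem tsum_pure_mul (a : α) (g : α → ENNReal) : ∑' b, PMF.pure a b * g b = g a := by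
  rw [tsum_eq_single a fun b hb => by rw [PMF.pure_apply_of_ne _ _ hb, zero_mul]]
  simp

theorem tsum_map_mul (P : PMF α) (f : α → β) (g : β → ENNReal) :
    ∑' b, P.map f b * g b = ∑' a, P a * g (f a) := by
  rw [PMF.map, tsum_bind_mul]
  simp only [Function.comp_apply, tsum_pure_mul]

theorem enorm_ofReal_toReal {x : ENNReal} (hx : x ≠ ⊤) : ‖((x.toReal : ℝ) : ℂ)‖ₑ = x := by
  rw [← ofReal_norm, Complex.norm_real, Real.norm_of_nonneg ENNReal.toReal_nonneg,
    ENNReal.ofReal_toReal hx]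

/-- The mean of `g` under `P`, as an unconditional sum. -/
def mean (P : PMF α) (g : α → ℂ) : ℂ := ∑' a, ((P a).toReal : ℂ) * g a

theorem mean_pure (a : α) (g : α → ℂ) : mean (PMF.pure a) g = g a := by
  rw [mean, tsum_eq_single a fun b hb => by rw [PMF.pure_apply_of_ne _ _ hb]; simp]
  simp

/-- Fubini for series: by Tonelli, the hypothesis says that the double series converges absolutely.
-/
theorem mean_bind (P : PMF α) (f : α → PMF β) (g : β → ℂ)
    (h : ∑' b, P.bind f b * ‖g b‖ₑ ≠ ⊤) :
    mean (P.bind f) g = ∑' a, ((P a).toReal : ℂ) * mean (f a) g := by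
  let F : α → β → ℂ := fun a b => ((P a).toReal : ℂ) * ((f a b).toReal : ℂ) * g b
  have hsum : Summable (Function.uncurry F) := by
    have hfin : ∑' x : α × β, ‖F x.1 x.2‖ₑ ≠ ⊤ := by
      convert h using 1
      rw [tsum_bind_mul, ENNReal.tsum_prod (f := fun a b => ‖F a b‖ₑ)]
      refine tsum_congr fun a => ?_
      rw [← ENNReal.tsum_mul_left]
      refine tsum_congr fun b => ?_
      simp only [F]
      rw [enorm_mul, enorm_mul, mul_assoc, enorm_ofReal_toReal (P.apply_ne_top a),
        enorm_ofReal_toReal ((f a).apply_ne_top b)]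
    refine Summable.of_norm ?_
    have := ENNReal.summable_toReal hfin
    simpa [Function.uncurry] using this
  have hb : ∀ b, ((P.bind f b).toReal : ℂ) * g b = ∑' a, F a b := by
    intro b
    rw [PMF.bind_apply, ENNReal.tsum_toReal_eq fun a =>
      ENNReal.mul_ne_top (P.apply_ne_top a) ((f a).apply_ne_top b), Complex.ofReal_tsum,
      ← tsum_mul_right]
    refine tsum_congr fun a => ?_
    simp [F]
  unfold mean
  rw [tsum_congr hb, hsum.tsum_comm]
  refine tsum_congr fun a => ?_
  rw [← tsum_mul_left]
  refine tsum_congr fun b => ?_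
  simp [F, mul_assoc]

theorem mean_map (P : PMF α) (f : α → β) (g : β → ℂ)
    (h : ∑' a, P a * ‖g (f a)‖ₑ ≠ ⊤) :
    mean (P.map f) g = mean P fun a => g (f a) := by
  rw [PMF.map, mean_bind]
  · simp only [Function.comp_apply, mean_pure]
    rfl
  · rw [tsum_bind_mul]
    simpa only [Function.comp_apply, tsum_pure_mul] using h

theorem integral_toMeasure_eq_mean [MeasurableSpace α] [MeasurableSingletonClass α] (P : PMF α)
    (g : α → ℂ) (h : Integrable g P.toMeasure) : ∫ a, g a ∂P.toMeasure = mean P g := by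
  rw [P.integral_eq_tsum g h, mean]
  simp only [Complex.real_smul]

theorem toPMF_poissonMeasure_apply (r : NNReal) (k : ℕ) :
    (poissonMeasure r).toPMF k = ENNReal.ofReal (Real.exp (-r) * r ^ k / k.factorial) := by
  rw [Measure.toPMF_apply, poissonMeasure_singleton]

/-- The probability generating function of the Poisson law, which integrates out one count in the
second-moment recursion. -/
theorem tsum_poisson_mul_pow (r : NNReal) {c g : ℝ} (hc : 0 ≤ c) (hg : 0 ≤ g) :
    ∑' k, (poissonMeasure r).toPMF k * ENNReal.ofReal (c * g ^ k) =
      ENNReal.ofReal (c * Real.exp (r * (g - 1))) := by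
  have hs : HasSum (fun k : ℕ => c * Real.exp (-r) * ((r * g) ^ k / (k.factorial : ℝ)))
      (c * Real.exp (-r) * Real.exp (r * g)) := by
    rw [Real.exp_eq_exp_ℝ]
    exact (NormedSpace.expSeries_div_hasSum_exp ((r : ℝ) * g)).mul_left _
  have : c * Real.exp (r * (g - 1)) = c * Real.exp (-r) * Real.exp (r * g) := by
    rw [mul_assoc, ← Real.exp_add]; congr 2; ring
  rw [this, ← hs.tsum_eq, ENNReal.ofReal_tsum_of_nonneg (fun k => by positivity) hs.summable]
  refine tsum_congr fun k => ?_
  rw [toPMF_poissonMeasure_apply, ← ENNReal.ofReal_mul (by positivity)]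
  congr 1
  rw [mul_pow]; ring

end PMFExpectation

/-! ### Second moments of the weights -/

section SecondMoment

variable {p : ℕ}

/-- The factor by which, in the second-moment bound, one copy of `x` is amplified by the strings
in `us`. -/
def growth (β γ : Fin p → ℝ) (R : Bits p → ℝ) (us : List (Bits p)) (x : Bits p) : ℝ :=
  (us.map fun u => Real.exp (1 / 4 * ‖bCoeff β u‖ * (1 + R u) * phaseGap γ x u)).prod

theorem growth_cons (β γ : Fin p → ℝ) (R : Bits p → ℝ) (u : Bits p) (us : List (Bits p))
    (x : Bits p) : growth β γ R (u :: us) x =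
      Real.exp (1 / 4 * ‖bCoeff β u‖ * (1 + R u) * phaseGap γ x u) * growth β γ R us x := by
  simp [growth]

theorem growth_pos (β γ : Fin p → ℝ) (R : Bits p → ℝ) (us : List (Bits p)) (x : Bits p) :
    0 < growth β γ R us x := by
  induction us with
  | nil => simp [growth]
  | cons u us ih => rw [growth_cons]; positivity

theorem abs_exp_neg_sub_exp_neg_le {a b : ℝ} (ha : 0 ≤ a) (hb : 0 ≤ b) :
    |Real.exp (-a) - Real.exp (-b)| ≤ |a - b| := by
  have key : ∀ {a b : ℝ}, 0 ≤ a → a ≤ b → |Real.exp (-a) - Real.exp (-b)| ≤ |a - b| := by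
    intro a b ha hab
    have h1 : Real.exp (-b) ≤ Real.exp (-a) := Real.exp_le_exp.2 (by linarith)
    have h2 : Real.exp (-b) = Real.exp (-a) * Real.exp (a - b) := by
      rw [← Real.exp_add]; congr 1; ring
    have h3 : Real.exp (-a) ≤ 1 := Real.exp_le_one_iff.2 (by linarith)
    have h4 := Real.add_one_le_exp (a - b)
    have h5 : Real.exp (a - b) ≤ 1 := Real.exp_le_one_iff.2 (by linarith)
    rw [abs_of_nonneg (by linarith), abs_of_nonpos (by linarith), h2]
    nlinarith [Real.exp_pos (-a)]
  rcases le_total a b with h | h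
  · exact key ha h
  · rw [abs_sub_comm, abs_sub_comm a b]; exact key hb h

theorem prod_map_damp_pow (n : ℕ) (γ : Fin p → ℝ) (done : List (Bits p)) (m : Bits p → ℕ)
    (x : Bits p) : (done.map fun v => damp n γ (bxor v x) ^ m v).prod =
      Real.exp (-((done.map fun v => (m v : ℝ) * phase γ (bxor v x) ^ 2).sum / (2 * n))) := by
  induction done with
  | nil => simp
  | cons v vs ih =>
    rw [List.map_cons, List.prod_cons, ih, List.map_cons, List.sum_cons, damp, ← Real.exp_nat_mul,
      ← Real.exp_add]
    congr 1; ring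

theorem abs_sum_map_sub_le (γ : Fin p → ℝ) (done : List (Bits p)) (m : Bits p → ℕ)
    (x y : Bits p) :
    |(done.map fun v => (m v : ℝ) * phase γ (bxor v x) ^ 2).sum -
      (done.map fun v => (m v : ℝ) * phase γ (bxor v y) ^ 2).sum| ≤
    (done.map fun v => (m v : ℝ) * |phase γ (bxor v x) ^ 2 - phase γ (bxor v y) ^ 2|).sum := by
  induction done with
  | nil => simp
  | cons v vs ih =>
    simp only [List.map_cons, List.sum_cons]
    have h1 : (m v : ℝ) * |phase γ (bxor v x) ^ 2 - phase γ (bxor v y) ^ 2| =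
        |(m v : ℝ) * phase γ (bxor v x) ^ 2 - (m v : ℝ) * phase γ (bxor v y) ^ 2| := by
      rw [← mul_sub, abs_mul, abs_of_nonneg (Nat.cast_nonneg (m v) : (0 : ℝ) ≤ m v)]
    rw [h1, add_sub_add_comm]
    exact (abs_add_le _ _).trans (by linarith)

theorem sum_map_mul_sq_nonneg (γ : Fin p → ℝ) (done : List (Bits p)) (m : Bits p → ℕ)
    (x : Bits p) : 0 ≤ (done.map fun v => (m v : ℝ) * phase γ (bxor v x) ^ 2).sum := by
  refine List.sum_nonneg fun a ha => ?_
  obtain ⟨v, _, rfl⟩ := List.mem_map.1 ha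
  positivity

/-- Both products in λ have the form e^{-T} with T ≥ 0, and e^{-x} is 1-Lipschitz there, so their
difference is at most the difference of the exponents. The exponents carry 1/(2n) and λ carries n/2:
n cancels and 1/4 remains. -/
theorem norm_intensity_le {n : ℕ} (hn : 0 < n) (β γ : Fin p → ℝ) (s t : Bits p)
    (done : List (Bits p)) (m : Bits p → ℕ) (u : Bits p) :
    ‖intensity n β γ s t done m u‖ ≤ 1 / 4 * ‖bCoeff β u‖ *
      (phaseGap γ s u + phaseGap γ t u +
        (done.map fun v => (m v : ℝ) * phaseGap γ v u).sum) := by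
  have hn' : (0 : ℝ) < n := by exact_mod_cast hn
  set S : Bits p → ℝ := fun x => (done.map fun v => (m v : ℝ) * phase γ (bxor v x) ^ 2).sum with hS
  set T : Bits p → ℝ := fun x =>
    (phase γ (bxor s x) ^ 2 + phase γ (bxor t x) ^ 2 + S x) / (2 * n) with hT
  have hprod : ∀ x, damp n γ (bxor s x) * damp n γ (bxor t x) *
      (done.map fun v => damp n γ (bxor v x) ^ m v).prod = Real.exp (-T x) := by
    intro x
    rw [prod_map_damp_pow, damp, damp, ← Real.exp_add, ← Real.exp_add]
    congr 1
    simp only [hT, hS]; ring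
  have hT0 : ∀ x, 0 ≤ T x := by
    intro x
    have := sum_map_mul_sq_nonneg γ done m x
    simp only [hT, hS]
    positivity
  have hdiff : |T (flip u) - T u| ≤ (phaseGap γ s u + phaseGap γ t u +
        (done.map fun v => (m v : ℝ) * phaseGap γ v u).sum) / (2 * n) := by
    have h1 : T (flip u) - T u = ((phase γ (bxor s (flip u)) ^ 2 - phase γ (bxor s u) ^ 2) +
        (phase γ (bxor t (flip u)) ^ 2 - phase γ (bxor t u) ^ 2) + (S (flip u) - S u)) /
          (2 * n) := by
      simp only [hT]; ring
    rw [h1, abs_div, abs_of_pos (by positivity : (0 : ℝ) < 2 * n)]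
    gcongr
    refine (abs_add_three _ _ _).trans ?_
    have h2 := abs_sum_map_sub_le γ done m u (flip u)
    rw [abs_sub_comm (phase γ (bxor s (flip u)) ^ 2), abs_sub_comm (phase γ (bxor t (flip u)) ^ 2),
      abs_sub_comm (S (flip u))]
    exact add_le_add le_rfl h2
  unfold intensity
  rw [hprod, hprod, norm_mul, Complex.norm_real, norm_div, norm_mul, Complex.norm_natCast,
    Real.norm_eq_abs, neg_add_eq_sub]
  have h3 := (abs_exp_neg_sub_exp_neg_le (hT0 (flip u)) (hT0 u)).trans hdiff
  calc (n : ℝ) * ‖bCoeff β u‖ / ‖(2 : ℂ)‖ * |Real.exp (-T (flip u)) - Real.exp (-T u)|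
      ≤ (n : ℝ) * ‖bCoeff β u‖ / ‖(2 : ℂ)‖ * ((phaseGap γ s u + phaseGap γ t u +
        (done.map fun v => (m v : ℝ) * phaseGap γ v u).sum) / (2 * n)) := by gcongr
    _ = _ := by
        rw [Complex.norm_ofNat]
        field_simp
        ring

theorem prod_map_growth_cons (β γ : Fin p → ℝ) (R : Bits p → ℝ) (u : Bits p)
    (us done : List (Bits p)) (m : Bits p → ℕ) :
    (done.map fun v => growth β γ R (u :: us) v ^ m v).prod =
      Real.exp (1 / 4 * ‖bCoeff β u‖ * (1 + R u) *
        (done.map fun v => (m v : ℝ) * phaseGap γ v u).sum) *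
      (done.map fun v => growth β γ R us v ^ m v).prod := by
  induction done with
  | nil => simp
  | cons v vs ih =>
    simp only [List.map_cons, List.prod_cons, List.sum_cons]
    have : 1 / 4 * ‖bCoeff β u‖ * (1 + R u) *
        ((m v : ℝ) * phaseGap γ v u + (vs.map fun v => (m v : ℝ) * phaseGap γ v u).sum) =
        (m v : ℝ) * (1 / 4 * ‖bCoeff β u‖ * (1 + R u) * phaseGap γ v u) +
        1 / 4 * ‖bCoeff β u‖ * (1 + R u) *
          (vs.map fun v => (m v : ℝ) * phaseGap γ v u).sum := by ring
    rw [ih, growth_cons, mul_pow, ← Real.exp_nat_mul, this, Real.exp_add]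
    ring

theorem prod_map_growth_pos (β γ : Fin p → ℝ) (R : Bits p → ℝ) (us done : List (Bits p))
    (m : Bits p → ℕ) : 0 < (done.map fun v => growth β γ R us v ^ m v).prod := by
  refine List.prod_pos fun a ha => ?_
  obtain ⟨v, _, rfl⟩ := List.mem_map.1 ha
  exact pow_pos (growth_pos _ _ _ _ _) _

/-- Backward induction on a bound of product form: one amplification factor for s, one for t and one
for each copy already drawn. Drawing m_u costs e^{2|λ|}, and summing g^{m_u} over the Poisson law
gives e^{|λ|(g - 1)}; the total e^{|λ|(1 + g)} with g ≤ R_u has an exponent linear in the counts, so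
the product form persists. This is the origin of 1 + R_u in `growth`. -/
theorem tsum_drawLoop_sq_le {n : ℕ} (hn : 0 < n) (β γ : Fin p → ℝ) (s t : Bits p)
    {R : Bits p → ℝ} {l : List (Bits p)} (hl : l.Nodup)
    (hR : ∀ a u b, l = a ++ u :: b → growth β γ R b u ≤ R u)
    (us done : List (Bits p)) (hdone : done ++ us = l) (m : Bits p → ℕ)
    (hm : ∀ u ∈ us, m u = 0) (M : ℂ) :
    ∑' r, drawLoop n β γ s t done us m M r * ENNReal.ofReal (‖r.2‖ ^ 2) ≤
      ENNReal.ofReal (‖M‖ ^ 2 * (growth β γ R us s * growth β γ R us t *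
        (done.map fun v => growth β γ R us v ^ m v).prod)) := by
  induction us generalizing done m M with
  | nil =>
    rw [drawLoop, tsum_pure_mul]
    simp [growth]
  | cons u us ih =>
    have hdone' : (done ++ [u]) ++ us = l := by simpa using hdone
    have hnd : (done ++ u :: us).Nodup := hdone ▸ hl
    have hu_done : u ∉ done := fun h =>
      (List.nodup_append.1 hnd).2.2 u h u List.mem_cons_self rfl
    have hu_us : u ∉ us := (List.nodup_cons.1 (List.nodup_append.1 hnd).2.1).1
    have hRu := hR done u us hdone.symm
    have hG := growth_pos β γ R us u
    set lam := intensity n β γ s t done m u with hlam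
    have hle := norm_intensity_le hn β γ s t done m u
    rw [← hlam] at hle
    set D := (done.map fun v => (m v : ℝ) * phaseGap γ v u).sum with hD
    have hGs := growth_pos β γ R us s
    have hGt := growth_pos β γ R us t
    have hGd := prod_map_growth_pos β γ R us done m
    set P := growth β γ R us s * growth β γ R us t *
      (done.map fun v => growth β γ R us v ^ m v).prod with hP
    have hP0 : 0 < P := by positivity
    have htarget : growth β γ R (u :: us) s * growth β γ R (u :: us) t *
        (done.map fun v => growth β γ R (u :: us) v ^ m v).prod =
        Real.exp (1 / 4 * ‖bCoeff β u‖ * (phaseGap γ s u + phaseGap γ t u + D) * (1 + R u)) *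
          P := by
      rw [prod_map_growth_cons, growth_cons, growth_cons, ← hD]
      have : 1 / 4 * ‖bCoeff β u‖ * (phaseGap γ s u + phaseGap γ t u + D) * (1 + R u) =
        1 / 4 * ‖bCoeff β u‖ * (1 + R u) * phaseGap γ s u +
        1 / 4 * ‖bCoeff β u‖ * (1 + R u) * phaseGap γ t u +
        1 / 4 * ‖bCoeff β u‖ * (1 + R u) * D := by ring
      rw [this, Real.exp_add, Real.exp_add, hP]
      ring
    have hexp : Real.exp (‖lam‖ * (1 + growth β γ R us u)) ≤
        Real.exp (1 / 4 * ‖bCoeff β u‖ * (phaseGap γ s u + phaseGap γ t u + D) * (1 + R u)) := by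
      apply Real.exp_le_exp.2
      exact mul_le_mul hle (by linarith) (by linarith) ((norm_nonneg _).trans hle)
    have hprod : ∀ k, ((done ++ [u]).map
        fun v => growth β γ R us v ^ Function.update m u k v).prod =
        (done.map fun v => growth β γ R us v ^ m v).prod * growth β γ R us u ^ k := by
      intro k
      rw [List.map_append, List.prod_append]
      congr 1
      · congr 1
        refine List.map_congr_left fun v hv => ?_
        rw [Function.update_of_ne (by rintro rfl; exact hu_done hv)]
      · simp
    rw [htarget, drawLoop]
    simp only [← hlam]
    split_ifs with h0
    -- No count is drawn when λ = 0; as `m u` still has its initial value 0, counting u as treated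
    -- contributes a factor 1.
    · have hmu : m u = 0 := hm u List.mem_cons_self
      refine (ih _ hdone' m (fun x hx => hm x (List.mem_cons_of_mem _ hx)) M).trans ?_
      have h1 := hprod 0
      rw [← hmu, Function.update_eq_self, hmu, pow_zero, mul_one] at h1
      rw [h1]
      apply ENNReal.ofReal_le_ofReal
      rw [← hP]
      have : (1 : ℝ) ≤ Real.exp (1 / 4 * ‖bCoeff β u‖ *
          (phaseGap γ s u + phaseGap γ t u + D) * (1 + R u)) := by
        refine le_trans ?_ hexp
        simp [h0]
      have h2 : P ≤ Real.exp (1 / 4 * ‖bCoeff β u‖ *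
          (phaseGap γ s u + phaseGap γ t u + D) * (1 + R u)) * P :=
        le_mul_of_one_le_left hP0.le this
      gcongr
    · rw [tsum_bind_mul]
      have hstep : ∀ k : ℕ, ∑' r, drawLoop n β γ s t (done ++ [u]) us (Function.update m u k)
          (M * (Real.exp ‖lam‖ : ℂ) * (lam / (‖lam‖ : ℂ)) ^ k) r * ENNReal.ofReal (‖r.2‖ ^ 2) ≤
          ENNReal.ofReal ((‖M‖ ^ 2 * Real.exp (2 * ‖lam‖) * P) * growth β γ R us u ^ k) := by
        intro k
        refine (ih _ hdone' _ (fun x hx => ?_) _).trans (le_of_eq ?_)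
        · rw [Function.update_of_ne (by rintro rfl; exact hu_us hx)]
          exact hm x (List.mem_cons_of_mem _ hx)
        · congr 1
          -- The phase has modulus 1, so the modulus of the weight does not depend on the count
          -- drawn.
          have hph : ‖lam / (‖lam‖ : ℂ)‖ = 1 := by
            rw [norm_div, Complex.norm_real, norm_norm, div_self (norm_ne_zero_iff.2 h0)]
          rw [hprod, norm_mul, norm_mul, norm_pow, hph, one_pow, mul_one, Complex.norm_real,
            Real.norm_of_nonneg (Real.exp_pos _).le, mul_pow, ← Real.exp_nat_mul, hP]
          push_cast
          ring
      refine (ENNReal.tsum_le_tsum fun k => mul_le_mul_right (hstep k) _).trans ?_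
      rw [tsum_poisson_mul_pow _ (by positivity) hG.le]
      apply ENNReal.ofReal_le_ofReal
      have : ‖M‖ ^ 2 * Real.exp (2 * ‖lam‖) * P *
          Real.exp ((‖lam‖₊ : ℝ) * (growth β γ R us u - 1)) =
          ‖M‖ ^ 2 * (Real.exp (‖lam‖ * (1 + growth β γ R us u)) * P) := by
        rw [coe_nnnorm]
        have : ‖lam‖ * (1 + growth β γ R us u) =
          2 * ‖lam‖ + ‖lam‖ * (growth β γ R us u - 1) := by ring
        rw [this, Real.exp_add]
        ring
      rw [this]
      gcongr

/-- The falling factorial is at most the power of n, the dampings are at most 1, and the base of the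
power is at most 1 by `sum_norm_bCoeff_le`. -/
theorem norm_finalFactor_le_one {n : ℕ} (hn : 0 < n) (β γ : Fin p → ℝ) (s t : Bits p)
    (l : List (Bits p)) (m : Bits p → ℕ) : ‖finalFactor n β γ s t l m‖ ≤ 1 := by
  have hn' : (0 : ℝ) < n := by exact_mod_cast hn
  unfold finalFactor
  simp only
  rw [norm_mul, norm_mul, norm_pow]
  refine mul_le_one₀ (mul_le_one₀ ?_ (norm_nonneg _) ?_) (by positivity)
    (pow_le_one₀ (norm_nonneg _) ?_)
  · rw [norm_div, norm_pow, Complex.norm_natCast, Complex.norm_natCast]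
    refine div_le_one_of_le₀ ?_ (by positivity)
    exact_mod_cast Nat.descFactorial_le_pow _ _
  · rw [Complex.norm_real, Real.norm_of_nonneg (damp_nonneg _ _ _)]
    exact damp_le_one _ _ _
  · have h1 : ‖∑ u : Bits p with level u = p,
        (oddSign u : ℂ) * bCoeff β u * ((damp n γ (bxor s u) * damp n γ (bxor t u) *
          (l.map fun v => damp n γ (bxor u v) ^ m v).prod : ℝ) : ℂ)‖ ≤ 2 := by
      refine (norm_sum_le _ _).trans (le_trans ?_ (sum_norm_bCoeff_le β))
      refine Finset.sum_le_sum fun u _ => ?_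
      have ho : ‖(oddSign u : ℂ)‖ = 1 := by
        unfold oddSign; split_ifs <;> simp
      have hd0 : 0 ≤ (l.map fun v => damp n γ (bxor u v) ^ m v).prod := by
        refine List.prod_nonneg fun a ha => ?_
        obtain ⟨v, _, rfl⟩ := List.mem_map.1 ha
        exact pow_nonneg (damp_nonneg _ _ _) _
      have hd1 : (l.map fun v => damp n γ (bxor u v) ^ m v).prod ≤ 1 := by
        clear hd0
        induction l with
        | nil => simp
        | cons v vs ih =>
          rw [List.map_cons, List.prod_cons]
          refine mul_le_one₀ (pow_le_one₀ (damp_nonneg _ _ _) (damp_le_one _ _ _)) ?_ ih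
          refine List.prod_nonneg fun a ha => ?_
          obtain ⟨v, _, rfl⟩ := List.mem_map.1 ha
          exact pow_nonneg (damp_nonneg _ _ _) _
      rw [norm_mul, norm_mul, ho, one_mul, Complex.norm_real, Real.norm_of_nonneg
        (mul_nonneg (mul_nonneg (damp_nonneg _ _ _) (damp_nonneg _ _ _)) hd0)]
      refine mul_le_of_le_one_right (norm_nonneg _) ?_
      exact mul_le_one₀ (mul_le_one₀ (damp_le_one _ _ _) (damp_nonneg _ _ _) (damp_le_one _ _ _))
        hd0 hd1
    rw [norm_mul, norm_div, norm_one, Complex.norm_ofNat]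
    linarith

end SecondMoment

/-! ### Mean and second moment of the random weights. -/

section WeightMoments

variable {p : ℕ}

/-- The constraint on R_u involves only the later strings, so it is solved with equality from the
end of the list. This yields finite second moments without reference to the bounding algorithm. -/
theorem exists_growth_bound (β γ : Fin p → ℝ) (l : List (Bits p)) (hl : l.Nodup) :
    ∃ R : Bits p → ℝ, ∀ a u b, l = a ++ u :: b → growth β γ R b u ≤ R u := by
  induction l with
  | nil => exact ⟨fun _ => 0, fun a u b h => by simp at h⟩
  | cons x l ih =>
    obtain ⟨hx, hl⟩ := List.nodup_cons.1 hl
    obtain ⟨R, hR⟩ := ih hl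
    have hcongr : ∀ b, (∀ v ∈ b, v ∈ l) → ∀ (y : Bits p) (c : ℝ),
        growth β γ (Function.update R x c) b y = growth β γ R b y := by
      intro b hb y c
      unfold growth
      congr 1
      refine List.map_congr_left fun v hv => ?_
      rw [Function.update_of_ne (by rintro rfl; exact hx (hb _ hv))]
    refine ⟨Function.update R x (growth β γ R l x), fun a u b h => ?_⟩
    cases a with
    | nil =>
      obtain ⟨rfl, rfl⟩ := List.cons.inj h
      rw [hcongr l fun v hv => hv, Function.update_self]
    | cons y a =>
      have h' : l = a ++ u :: b := (List.cons.inj h).2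
      have hu : u ∈ l := by rw [h']; simp
      rw [hcongr b fun v hv => by rw [h']; simp [hv],
        Function.update_of_ne (by rintro rfl; exact hx hu)]
      exact hR a u b h'

/-- Absolute convergence follows from the second moment through x ≤ 1 + x², the final factor having
norm at most 1. -/
theorem tsum_drawLoop_enorm_ne_top {n : ℕ} (hn : 0 < n) (β γ : Fin p → ℝ) (s t : Bits p)
    {l : List (Bits p)} (hl : l.Nodup) (us done : List (Bits p)) (hdone : done ++ us = l)
    (m : Bits p → ℕ) (hm : ∀ u ∈ us, m u = 0) (M : ℂ) :
    ∑' r, drawLoop n β γ s t done us m M r * ‖r.2 * finalFactor n β γ s t l r.1‖ₑ ≠ ⊤ := by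
  obtain ⟨R, hR⟩ := exists_growth_bound β γ l hl
  have h := tsum_drawLoop_sq_le hn β γ s t hl hR us done hdone m hm M
  have hle : ∑' r, drawLoop n β γ s t done us m M r * ‖r.2 * finalFactor n β γ s t l r.1‖ₑ ≤
      ∑' r, drawLoop n β γ s t done us m M r * (1 + ENNReal.ofReal (‖r.2‖ ^ 2)) := by
    refine ENNReal.tsum_le_tsum fun r => mul_le_mul_right ?_ _
    rw [← ofReal_norm, ← ENNReal.ofReal_one, ← ENNReal.ofReal_add zero_le_one (by positivity)]
    apply ENNReal.ofReal_le_ofReal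
    rw [norm_mul]
    have h1 := norm_finalFactor_le_one hn β γ s t l r.1
    have h2 : ‖r.2‖ * ‖finalFactor n β γ s t l r.1‖ ≤ ‖r.2‖ :=
      mul_le_of_le_one_right (norm_nonneg _) h1
    nlinarith [sq_nonneg (‖r.2‖ - 1)]
  refine ne_top_of_le_ne_top ?_ hle
  simp only [mul_add, mul_one]
  rw [ENNReal.tsum_add, PMF.tsum_coe]
  exact ENNReal.add_ne_top.2 ⟨ENNReal.one_ne_top, ne_top_of_le_ne_top ENNReal.ofReal_ne_top h⟩

/-- Importance weighting: the Poisson probability e^{-|λ|} |λ|^k / k! times e^{|λ|} (λ/|λ|)^k is λ^k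
/ k!. -/
theorem mean_drawLoop {n : ℕ} (hn : 0 < n) (β γ : Fin p → ℝ) (s t : Bits p)
    {l : List (Bits p)} (hl : l.Nodup) (us done : List (Bits p)) (hdone : done ++ us = l)
    (m : Bits p → ℕ) (hm : ∀ u ∈ us, m u = 0) (M : ℂ) :
    mean (drawLoop n β γ s t done us m M) (fun r => r.2 * finalFactor n β γ s t l r.1) =
      M * loopMean n β γ s t l done us m := by
  induction us generalizing done m M with
  | nil => rw [drawLoop, mean_pure, loopMean]
  | cons u us ih =>
    have hfin := tsum_drawLoop_enorm_ne_top hn β γ s t hl (u :: us) done hdone m hm M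
    have hdone' : (done ++ [u]) ++ us = l := by simpa using hdone
    have hu_us : u ∉ us :=
      (List.nodup_cons.1 (List.nodup_append.1 (hdone ▸ hl)).2.1).1
    rw [drawLoop] at hfin ⊢
    rw [loopMean]
    set lam := intensity n β γ s t done m u with hlam
    simp only [← hlam] at hfin ⊢
    split_ifs at hfin ⊢ with h0
    -- For λ = 0 the series in `loopMean` reduces to its term k = 0, with 0^0 = 1.
    · rw [ih _ hdone' m (fun x hx => hm x (List.mem_cons_of_mem _ hx)) M,
        tsum_eq_single 0 fun k hk => by rw [h0, zero_pow hk]; simp]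
      have hmu : Function.update m u 0 = m := by
        rw [← hm u List.mem_cons_self, Function.update_eq_self]
      simp [hmu]
    · rw [mean_bind _ _ _ hfin, ← tsum_mul_left]
      refine tsum_congr fun k => ?_
      rw [ih _ hdone' _ fun x hx => ?_]
      · have hl0 : (‖lam‖ : ℂ) ≠ 0 := by
          exact_mod_cast norm_ne_zero_iff.2 h0
        rw [toPMF_poissonMeasure_apply, ENNReal.toReal_ofReal (by positivity), div_pow, coe_nnnorm,
          Real.exp_neg]
        have he : (Real.exp ‖lam‖ : ℂ) ≠ 0 := by exact_mod_cast (Real.exp_pos _).ne'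
        push_cast at he ⊢
        have hk0 : (k.factorial : ℂ) ≠ 0 := by exact_mod_cast k.factorial_ne_zero
        field_simp
      · rw [Function.update_of_ne (by rintro rfl; exact hu_us hx)]
        exact hm x (List.mem_cons_of_mem _ hx)

theorem mean_weightLaw {n : ℕ} (hn : 0 < n) (β γ : Fin p → ℝ) {l : List (Bits p)}
    (hl : IsOddList l) (s t : Bits p) :
    mean (weightLaw n β γ l s t) id =
      (n.descFactorial 2 : ℂ) / (n : ℂ) ^ 2 * (damp n γ (bxor s t) : ℂ) *
        ((1 / 2) ^ (n - 2) * interactionSum (dampC n γ) Finset.univ (n - 2)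
            fun x => (oddSign x : ℂ) * bCoeff β x * (dampC n γ s x * dampC n γ t x)) := by
  have hfin := tsum_drawLoop_enorm_ne_top hn β γ s t hl.nodup l [] rfl (fun _ => 0)
    (fun _ _ => rfl) 1
  rw [weightLaw, mean_map _ _ _ (by simpa using hfin)]
  have h := mean_drawLoop hn β γ s t hl.nodup l [] rfl (fun _ => 0) (fun _ _ => rfl) 1
  simp only [id]
  rw [h, one_mul, loopMean_eq hn β γ s t hl l [] rfl, flipClosure_eq_univ hl]
  simp only [List.map_nil, List.sum_nil, Nat.zero_add, Nat.sub_zero]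
  congr 3
  funext x
  simp [siteWeight, dampC]

theorem lintegral_weightLaw_le {n : ℕ} (hn : 0 < n) (β γ : Fin p → ℝ) {l : List (Bits p)}
    (hl : l.Nodup) {R : Bits p → ℝ} (hR : ∀ a u b, l = a ++ u :: b → growth β γ R b u ≤ R u)
    (s t : Bits p) :
    ∫⁻ z, ENNReal.ofReal (‖z‖ ^ 2) ∂(weightLaw n β γ l s t).toMeasure ≤
      ENNReal.ofReal (growth β γ R l s * growth β γ R l t) := by
  have h := tsum_drawLoop_sq_le hn β γ s t hl hR l [] rfl (fun _ => 0) (fun _ _ => rfl) 1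
  rw [lintegral_toMeasure, weightLaw, tsum_map_mul]
  refine (ENNReal.tsum_le_tsum fun r => mul_le_mul_right ?_ _).trans (h.trans (by simp))
  apply ENNReal.ofReal_le_ofReal
  rw [norm_mul]
  have h1 := norm_finalFactor_le_one hn β γ s t l r.1
  gcongr
  exact mul_le_of_le_one_right (norm_nonneg _) h1

theorem memLp_weightLaw {n : ℕ} (hn : 0 < n) (β γ : Fin p → ℝ) {l : List (Bits p)}
    (hl : l.Nodup) (s t : Bits p) : MemLp id 2 (weightLaw n β γ l s t).toMeasure := by
  obtain ⟨R, hR⟩ := exists_growth_bound β γ l hl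
  have h := lintegral_weightLaw_le (n := n) hn β γ hl hR s t
  refine (memLp_two_iff_integrable_sq_norm measurable_id.aestronglyMeasurable).2 ?_
  refine ⟨by fun_prop, ?_⟩
  rw [hasFiniteIntegral_iff_ofReal (.of_forall fun _ => by positivity)]
  exact h.trans_lt ENNReal.ofReal_lt_top

theorem integral_sq_norm_weightLaw_le {n : ℕ} (hn : 0 < n) (β γ : Fin p → ℝ)
    {l : List (Bits p)} (hl : l.Nodup) {R : Bits p → ℝ}
    (hR : ∀ a u b, l = a ++ u :: b → growth β γ R b u ≤ R u) (s t : Bits p) :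
    ∫ z, ‖z‖ ^ 2 ∂(weightLaw n β γ l s t).toMeasure ≤ growth β γ R l s * growth β γ R l t := by
  rw [integral_eq_lintegral_of_nonneg_ae (.of_forall fun _ => by positivity) (by fun_prop)]
  refine ENNReal.toReal_le_of_le_ofReal ?_ (lintegral_weightLaw_le hn β γ hl hR s t)
  exact mul_nonneg (growth_pos _ _ _ _ _).le (growth_pos _ _ _ _ _).le

end WeightMoments

/-! ### The output of the bounding algorithm -/

section BoundingAlgorithm

variable {p : ℕ}

/-- All strings of the list are odd and of level `< p`. -/
def OddBelow (l : List (Bits p)) : Prop := ∀ u ∈ l, IsOdd u ∧ level u < p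

/-- By parity the pairs {u, F(u)} of distinct listed strings are disjoint, so the paired assignments
never overwrite one another. -/
theorem OddBelow.flip_ne {l : List (Bits p)} (h : OddBelow l) {u v : Bits p} (hu : u ∈ l)
    (hv : v ∈ l) : flip u ≠ v := by
  rintro rfl
  exact (isOdd_flip u (h u hu).2).1 (h _ hv).1 (h u hu).1

theorem OddBelow.tail {u : Bits p} {l : List (Bits p)} (h : OddBelow (u :: l)) : OddBelow l :=
  fun v hv => h v (List.mem_cons_of_mem _ hv)

theorem flip_injective : Function.Injective (flip : Bits p → Bits p) := fun x y h => by
  rw [← flip_flip x, h, flip_flip]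

theorem assignPair_self (R : Bits p → ℝ) (s : Bits p) (x : ℝ) : assignPair R s x s = x := by
  unfold assignPair
  by_cases h : s = flip s
  · rw [Function.update_apply, if_pos h]
  · rw [Function.update_of_ne h, Function.update_self]

theorem assignPair_flip (R : Bits p → ℝ) (s : Bits p) (x : ℝ) :
    assignPair R s x (flip s) = x := by
  unfold assignPair
  rw [Function.update_self]

theorem assignPair_of_ne (R : Bits p → ℝ) {s y : Bits p} (x : ℝ) (h : y ≠ s) (h' : y ≠ flip s) :
    assignPair R s x y = R y := by
  unfold assignPair
  rw [Function.update_of_ne h', Function.update_of_ne h]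

theorem foldl_assignPair_of_notMem (f : Bits p → ℝ) (l : List (Bits p)) (R : Bits p → ℝ)
    {y : Bits p} (h : ∀ u ∈ l, y ≠ u ∧ y ≠ flip u) :
    l.foldl (fun R s => assignPair R s (f s)) R y = R y := by
  induction l generalizing R with
  | nil => rfl
  | cons u us ih =>
    rw [List.foldl_cons, ih _ fun v hv => h v (List.mem_cons_of_mem _ hv)]
    exact assignPair_of_ne R _ (h u List.mem_cons_self).1 (h u List.mem_cons_self).2

theorem foldl_assignPair_of_mem (f : Bits p → ℝ) {l : List (Bits p)} (hl : l.Nodup)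
    (ho : OddBelow l) (R : Bits p → ℝ) {x : Bits p} (hx : x ∈ l) :
    l.foldl (fun R s => assignPair R s (f s)) R x = f x ∧
      l.foldl (fun R s => assignPair R s (f s)) R (flip x) = f x := by
  induction l generalizing R with
  | nil => simp at hx
  | cons u us ih =>
    obtain ⟨hu, hus⟩ := List.nodup_cons.1 hl
    rcases List.mem_cons.1 hx with rfl | hx'
    · rw [List.foldl_cons, foldl_assignPair_of_notMem, foldl_assignPair_of_notMem]
      · exact ⟨assignPair_self _ _ _, assignPair_flip _ _ _⟩
      · intro v hv
        refine ⟨ho.flip_ne hx (List.mem_cons_of_mem _ hv), fun h => ?_⟩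
        exact hu (flip_injective h ▸ hv)
      · intro v hv
        refine ⟨by rintro rfl; exact hu hv, fun h => ?_⟩
        exact ho.flip_ne (List.mem_cons_of_mem _ hv) hx h.symm
    · rw [List.foldl_cons]
      exact ih hus ho.tail _ hx'

/-- The effect of the inner loop for the string `s`. -/
theorem innerLoop_spec (β γ : Fin p → ℝ) (s : Bits p) {ts : List (Bits p)}
    (hnd : (s :: ts).Nodup) (ho : OddBelow (s :: ts)) (R : Bits p → ℝ) :
    (∀ y, (∀ u ∈ ts, y ≠ u ∧ y ≠ flip u) → ts.foldr (fun t R' => assignPair R' t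
        (R' t * Real.exp (1 / 4 * R' s * ‖bCoeff β s‖ * phaseGap γ t s))) R y = R y) ∧
    ∀ x ∈ ts, ts.foldr (fun t R' => assignPair R' t
        (R' t * Real.exp (1 / 4 * R' s * ‖bCoeff β s‖ * phaseGap γ t s))) R x =
          R x * Real.exp (1 / 4 * R s * ‖bCoeff β s‖ * phaseGap γ x s) ∧
      ts.foldr (fun t R' => assignPair R' t
        (R' t * Real.exp (1 / 4 * R' s * ‖bCoeff β s‖ * phaseGap γ t s))) R (flip x) =
          R x * Real.exp (1 / 4 * R s * ‖bCoeff β s‖ * phaseGap γ x s) := by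
  induction ts with
  | nil => simp
  | cons t ts ih =>
    obtain ⟨hs, hnd'⟩ := List.nodup_cons.1 hnd
    obtain ⟨ht, hts⟩ := List.nodup_cons.1 hnd'
    have hst : s ∉ ts := fun h => hs (List.mem_cons_of_mem _ h)
    have ho' : OddBelow (s :: ts) := by
      intro u hu
      rcases List.mem_cons.1 hu with rfl | hu
      · exact ho _ List.mem_cons_self
      · exact ho u (List.mem_cons_of_mem _ (List.mem_cons_of_mem _ hu))
    obtain ⟨ih1, ih2⟩ := ih (List.nodup_cons.2 ⟨hst, hts⟩) ho'
    -- The inner loop rereads `R' s` at every turn but never writes to it.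
    have hs' := ih1 s fun u hu => ⟨by rintro rfl; exact hst hu, fun h =>
      ho'.flip_ne (List.mem_cons_of_mem _ hu) List.mem_cons_self h.symm⟩
    have ht' := ih1 t fun u hu => ⟨by rintro rfl; exact ht hu, fun h =>
      ho.tail.flip_ne (List.mem_cons_of_mem _ hu) List.mem_cons_self h.symm⟩
    simp only [List.foldr_cons]
    rw [hs', ht']
    refine ⟨fun y hy => ?_, fun x hx => ?_⟩
    · rw [assignPair_of_ne _ _ (hy t List.mem_cons_self).1 (hy t List.mem_cons_self).2]
      exact ih1 y fun u hu => hy u (List.mem_cons_of_mem _ hu)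
    · rcases List.mem_cons.1 hx with rfl | hx'
      · exact ⟨assignPair_self _ _ _, assignPair_flip _ _ _⟩
      · have hxt : x ≠ t := by rintro rfl; exact ht hx'
        rw [assignPair_of_ne _ _ hxt (ho.tail.flip_ne List.mem_cons_self hx).symm,
          assignPair_of_ne _ _ (ho.tail.flip_ne hx List.mem_cons_self)
            fun h => hxt (flip_injective h)]
        exact ih2 x hx'

theorem rHatLoop_of_notMem (β γ : Fin p → ℝ) {L : List (Bits p)} (hnd : L.Nodup)
    (ho : OddBelow L) (R : Bits p → ℝ) {y : Bits p} (hy : ∀ u ∈ L, y ≠ u ∧ y ≠ flip u) :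
    rHatLoop β γ L R y = R y := by
  induction L generalizing R with
  | nil => rfl
  | cons s ts ih =>
    have hy' : ∀ u ∈ ts, y ≠ u ∧ y ≠ flip u := fun u hu => hy u (List.mem_cons_of_mem _ hu)
    rw [rHatLoop, ih (List.nodup_cons.1 hnd).2 ho.tail _ hy']
    exact (innerLoop_spec β γ s hnd ho R).1 y hy'

theorem rHatLoop_flip (β γ : Fin p → ℝ) {L : List (Bits p)} (hnd : L.Nodup)
    (ho : OddBelow L) (R : Bits p → ℝ) (hR : ∀ x ∈ L, R (flip x) = R x) :
    ∀ x ∈ L, rHatLoop β γ L R (flip x) = rHatLoop β γ L R x := by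
  induction L generalizing R with
  | nil => simp
  | cons s ts ih =>
    obtain ⟨hs, hts⟩ := List.nodup_cons.1 hnd
    obtain ⟨h1, h2⟩ := innerLoop_spec β γ s hnd ho R
    intro x hx
    rw [rHatLoop]
    rcases List.mem_cons.1 hx with rfl | hx'
    · have hne : ∀ u ∈ ts, x ≠ u ∧ x ≠ flip u := fun u hu =>
        ⟨by rintro rfl; exact hs hu, (ho.flip_ne (List.mem_cons_of_mem _ hu) hx).symm⟩
      have hne' : ∀ u ∈ ts, flip x ≠ u ∧ flip x ≠ flip u := fun u hu =>
        ⟨ho.flip_ne hx (List.mem_cons_of_mem _ hu), fun h => (hne u hu).1 (flip_injective h)⟩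
      rw [rHatLoop_of_notMem β γ hts ho.tail _ hne, rHatLoop_of_notMem β γ hts ho.tail _ hne',
        h1 x hne, h1 _ hne', hR x hx]
    · exact ih hts ho.tail _ (fun y hy => by rw [(h2 y hy).1, (h2 y hy).2]) x hx'

/-- The value at s is final once s becomes the head of the reversed list, so the factors it passes
on may be expressed through the output itself: the imperative loop becomes a triangular system of
equations. -/
theorem rHatLoop_eq (β γ : Fin p → ℝ) {L : List (Bits p)} (hnd : L.Nodup)
    (ho : OddBelow L) (R : Bits p → ℝ) (pre post : List (Bits p)) (x : Bits p)
    (hL : L = pre ++ x :: post) :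
    rHatLoop β γ L R x = R x * (pre.map fun u =>
      Real.exp (1 / 4 * rHatLoop β γ L R u * ‖bCoeff β u‖ * phaseGap γ x u)).prod := by
  induction L generalizing R pre with
  | nil => simp at hL
  | cons s ts ih =>
    obtain ⟨hs, hts⟩ := List.nodup_cons.1 hnd
    obtain ⟨h1, h2⟩ := innerLoop_spec β γ s hnd ho R
    have hne : ∀ u ∈ ts, s ≠ u ∧ s ≠ flip u := fun u hu =>
      ⟨by rintro rfl; exact hs hu,
        (ho.flip_ne (List.mem_cons_of_mem _ hu) List.mem_cons_self).symm⟩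
    have hhead : rHatLoop β γ (s :: ts) R s = R s := by
      rw [rHatLoop, rHatLoop_of_notMem β γ hts ho.tail _ hne, h1 s hne]
    cases pre with
    | nil =>
      obtain ⟨rfl, rfl⟩ := List.cons.inj hL
      rw [hhead]; simp
    | cons y pre =>
      obtain ⟨rfl, hts'⟩ := List.cons.inj hL
      have hx : x ∈ ts := by rw [hts']; simp
      rw [List.map_cons, List.prod_cons, hhead, rHatLoop, ih hts ho.tail _ pre hts', (h2 x hx).1]
      ring

/-- The exponent |B_u|(1 + R_u) splits into two parts: the initial exponential pays for |B_u|
because |B_u| ≤ w_u, and the second loop pays for |B_u| R_u. Both choices of weights are covered at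
once. -/
theorem growth_le_rHat (β γ : Fin p → ℝ) {l : List (Bits p)} (hl : IsOddList l)
    {w : Bits p → ℝ} (hw : ∀ t, ‖bCoeff β t‖ ≤ w t) (x : Bits p) :
    growth β γ (rHat w β γ l) l x ≤ rHat w β γ l x := by
  set R := rHat w β γ l with hR
  have hw0 : ∀ t, 0 ≤ w t := fun t => (norm_nonneg _).trans (hw t)
  have hodd : OddBelow l := fun u hu => (hl.mem_iff u).1 hu
  have hodd' : OddBelow l.reverse := fun u hu => hodd u (List.mem_reverse.1 hu)
  have hnd' : l.reverse.Nodup := List.nodup_reverse.2 hl.nodup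
  have hinit : ∀ x ∈ l, rHatInit w γ l x = Real.exp (1 / 4 *
      ∑ t : Bits p with IsOdd t ∧ level t < p, w t * phaseGap γ x t) ∧
      rHatInit w γ l (flip x) = rHatInit w γ l x := by
    intro x hx
    have h := foldl_assignPair_of_mem (fun s => Real.exp (1 / 4 *
      ∑ t : Bits p with IsOdd t ∧ level t < p, w t * phaseGap γ s t)) hl.nodup hodd
      (fun _ => 1) hx
    exact ⟨h.1, h.2.trans h.1.symm⟩
  have hlist : ∀ x, (l.map fun t => w t * phaseGap γ x t).sum =
      ∑ t : Bits p with IsOdd t ∧ level t < p, w t * phaseGap γ x t := by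
    intro x
    rw [← List.sum_toFinset _ hl.nodup]
    refine Finset.sum_congr ?_ fun _ _ => rfl
    ext t
    simp [hl.mem_iff]
  have hmem : ∀ x ∈ l, growth β γ R l x ≤ R x := by
    intro x hx
    obtain ⟨a, b, hab⟩ := List.append_of_mem hx
    have hrev : l.reverse = b.reverse ++ x :: a.reverse := by rw [hab]; simp
    have h1 := rHatLoop_eq β γ hnd' hodd' (rHatInit w γ l) _ _ x hrev
    have hsort := hl.sorted
    rw [hab] at hsort
    -- Strings before x have level at most that of x and do not amplify it, so only the tail `b`
    -- matters.
    have ha : ∀ u ∈ a, phaseGap γ x u = 0 := fun u hu =>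
      phaseGap_eq_zero γ ((List.pairwise_append.1 hsort).2.2 u hu x List.mem_cons_self)
    change R x = _ * (b.reverse.map fun u =>
      Real.exp (1 / 4 * R u * ‖bCoeff β u‖ * phaseGap γ x u)).prod at h1
    rw [h1, (hinit x hx).1, ← hlist x, hab]
    have hprodrev : (b.reverse.map fun u =>
        Real.exp (1 / 4 * R u * ‖bCoeff β u‖ * phaseGap γ x u)).prod =
        (b.map fun u => Real.exp (1 / 4 * R u * ‖bCoeff β u‖ * phaseGap γ x u)).prod := by
      rw [List.map_reverse, List.prod_reverse]
    rw [hprodrev]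
    have hga : growth β γ R a x = 1 := by
      unfold growth
      refine List.prod_eq_one fun y hy => ?_
      obtain ⟨u, hu, rfl⟩ := List.mem_map.1 hy
      rw [ha u hu, mul_zero, Real.exp_zero]
    have hsplit : growth β γ R (a ++ x :: b) x = growth β γ R b x := by
      have : growth β γ R (a ++ x :: b) x = growth β γ R a x * growth β γ R (x :: b) x := by
        simp [growth]
      rw [this, hga, one_mul, growth_cons, phaseGap_eq_zero γ le_rfl, mul_zero, Real.exp_zero,
        one_mul]
    rw [hsplit]
    have hsum : (b.map fun t => w t * phaseGap γ x t).sum ≤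
        ((a ++ x :: b).map fun t => w t * phaseGap γ x t).sum := by
      rw [List.map_append, List.sum_append, List.map_cons, List.sum_cons]
      have h2 : 0 ≤ (a.map fun t => w t * phaseGap γ x t).sum := by
        refine List.sum_nonneg fun y hy => ?_
        obtain ⟨u, _, rfl⟩ := List.mem_map.1 hy
        exact mul_nonneg (hw0 u) (phaseGap_nonneg _ _ _)
      have h3 := mul_nonneg (hw0 x) (phaseGap_nonneg γ x x)
      linarith
    have hstep : growth β γ R b x ≤ Real.exp (1 / 4 * (b.map fun t => w t * phaseGap γ x t).sum) *
        (b.map fun u => Real.exp (1 / 4 * R u * ‖bCoeff β u‖ * phaseGap γ x u)).prod := by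
      clear hsplit hsum hprodrev h1 hrev hsort hab
      induction b with
      | nil => simp [growth]
      | cons u b ih =>
        rw [growth_cons]
        simp only [List.map_cons, List.sum_cons, List.prod_cons]
        have h2 : Real.exp (1 / 4 * ‖bCoeff β u‖ * (1 + R u) * phaseGap γ x u) ≤
            Real.exp (1 / 4 * (w u * phaseGap γ x u)) *
              Real.exp (1 / 4 * R u * ‖bCoeff β u‖ * phaseGap γ x u) := by
          rw [← Real.exp_add]
          apply Real.exp_le_exp.2
          have := mul_le_mul_of_nonneg_right (hw u) (phaseGap_nonneg γ x u)
          nlinarith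
        refine (mul_le_mul h2 ih (growth_pos _ _ _ _ _).le (by positivity)).trans (le_of_eq ?_)
        rw [mul_add, Real.exp_add]
        ring
    refine hstep.trans ?_
    refine mul_le_mul_of_nonneg_right ?_ (List.prod_nonneg fun y hy => ?_)
    · apply Real.exp_le_exp.2
      linarith
    · obtain ⟨u, _, rfl⟩ := List.mem_map.1 hy
      positivity
  have hflip : ∀ x ∈ l, R (flip x) = R x := fun x hx =>
    rHatLoop_flip β γ hnd' hodd' _ (fun y hy => (hinit y (List.mem_reverse.1 hy)).2) x
      (List.mem_reverse.2 hx)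
  have hgflip : ∀ x, growth β γ R l (flip x) = growth β γ R l x := by
    intro x
    unfold growth
    simp only [phaseGap_flip_left]
  rcases (level_le x).lt_or_eq with h | h
  · by_cases ho : IsOdd x
    · exact hmem x ((hl.mem_iff x).2 ⟨ho, h⟩)
    -- An even string inherits the estimate from its odd partner, both sides being invariant under
    -- the flip.
    · have hx : flip x ∈ l :=
        (hl.mem_iff _).2 ⟨(isOdd_flip x h).2 ho, by rwa [level_flip]⟩
      have h1 := hmem _ hx
      have h2 := hflip _ hx
      rw [flip_flip] at h2
      rwa [hgflip, ← h2] at h1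
  -- Strings of level p are never assigned to, so R̂ keeps the value 1, and nothing amplifies them.
  · have hne : ∀ u ∈ l, x ≠ u ∧ x ≠ flip u := by
      intro u hu
      have := (hodd u hu).2
      refine ⟨?_, ?_⟩
      · rintro rfl; omega
      · rintro rfl; rw [level_flip] at h; omega
    have hRx : R x = 1 := by
      rw [hR, rHat, rHatLoop_of_notMem β γ hnd' hodd' _ fun u hu => hne u (List.mem_reverse.1 hu)]
      exact foldl_assignPair_of_notMem _ _ _ hne
    rw [hRx]
    refine le_of_eq ?_
    unfold growth
    refine List.prod_eq_one fun y hy => ?_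
    obtain ⟨u, hu, rfl⟩ := List.mem_map.1 hy
    rw [phaseGap_eq_zero γ (by rw [h]; exact level_le u), mul_zero, Real.exp_zero]

end BoundingAlgorithm

/-! ### The QAOA state as a sum over paths -/

section PathSum

theorem sign_mul_self (b : Bool) : sign b * sign b = 1 := by cases b <;> simp [sign]

theorem sign_xor (a b : Bool) : sign (xor a b) = sign a * sign b := by
  cases a <;> cases b <;> simp [sign]

/-- One factor of the Walsh-Hadamard matrix. -/
def hadamardFactor (x y : Bool) : ℂ := if x && y then -1 else 1

/-- The unnormalised Walsh-Hadamard matrix on `n` qubits. -/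
def hadamard (n : ℕ) : Matrix (Basis n) (Basis n) ℂ :=
  Matrix.of fun x y => ∏ k, hadamardFactor (x k) (y k)

theorem prod_sum_bool {n : ℕ} (f : Fin n → Bool → ℂ) :
    ∏ k, ∑ b, f k b = ∑ z : Basis n, ∏ k, f k (z k) := by
  rw [Finset.prod_univ_sum, Fintype.piFinset_univ]

theorem hadamard_mul_self (n : ℕ) : hadamard n * hadamard n = (2 ^ n : ℂ) • 1 := by
  ext x y
  rw [Matrix.mul_apply]
  simp only [hadamard, Matrix.of_apply, ← Finset.prod_mul_distrib]
  rw [← prod_sum_bool fun k b => hadamardFactor (x k) b * hadamardFactor b (y k)]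
  have h : ∀ k, ∑ b, hadamardFactor (x k) b * hadamardFactor b (y k) =
      if x k = y k then 2 else 0 := by
    intro k
    cases x k <;> cases y k <;> (simp [hadamardFactor]; try norm_num)
  rw [Finset.prod_congr rfl fun k _ => h k, Matrix.smul_apply, Matrix.one_apply]
  by_cases hxy : x = y
  · subst hxy; simp
  · obtain ⟨k, hk⟩ := Function.ne_iff.1 hxy
    rw [Finset.prod_eq_zero (Finset.mem_univ k) (by rw [if_neg hk]), if_neg hxy]
    simp

/-- Columns of the Walsh-Hadamard matrix are joint eigenvectors of the X_k, with eigenvalues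
(-1)^{y_k}. -/
theorem mixer_mul_hadamard (n : ℕ) :
    mixer n * hadamard n = hadamard n * Matrix.diagonal fun y => ∑ k, (sign (y k) : ℂ) := by
  ext x y
  rw [Matrix.mul_diagonal, mixer, Finset.sum_mul, Matrix.sum_apply, Finset.mul_sum]
  refine Finset.sum_congr rfl fun k _ => ?_
  rw [Matrix.mul_apply]
  have hflip : ∀ z : Basis n, x = Function.update z k (!(z k)) ↔
      z = Function.update x k (!(x k)) := by
    intro z
    constructor <;> · rintro rfl; simp
  simp only [pauliX, Matrix.of_apply, hflip, ite_mul, one_mul, zero_mul, Finset.sum_ite_eq',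
    Finset.mem_univ, if_true, hadamard]
  rw [← Finset.mul_prod_erase _ _ (Finset.mem_univ k),
    ← Finset.mul_prod_erase (a := k) (f := fun k => hadamardFactor (x k) (y k)) _
      (Finset.mem_univ k)]
  have : ∏ i ∈ Finset.univ.erase k, hadamardFactor (Function.update x k (!(x k)) i) (y i) =
      ∏ i ∈ Finset.univ.erase k, hadamardFactor (x i) (y i) :=
    Finset.prod_congr rfl fun i hi => by rw [Function.update_of_ne (Finset.ne_of_mem_erase hi)]
  rw [this, Function.update_self, mul_right_comm]
  congr 1
  cases x k <;> cases y k <;> simp [hadamardFactor, sign]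

/-- After diagonalisation the exponential of the sum over qubits is a product, and the sum over
intermediate configurations factorises qubit by qubit. -/
theorem exp_smul_mixer (n : ℕ) (c : ℂ) (x y : Basis n) :
    NormedSpace.exp (c • mixer n) x y =
      ∏ k, if x k = y k then Complex.cosh c else Complex.sinh c := by
  have h2 : (2 ^ n : ℂ) ≠ 0 := pow_ne_zero _ two_ne_zero
  have hinv : hadamard n * ((2 ^ n : ℂ)⁻¹ • hadamard n) = 1 := by
    rw [Matrix.mul_smul, hadamard_mul_self, smul_smul, inv_mul_cancel₀ h2, one_smul]
  have hU : IsUnit (hadamard n) := IsUnit.of_mul_eq_one _ hinv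
  have hinv' : (hadamard n)⁻¹ = (2 ^ n : ℂ)⁻¹ • hadamard n := Matrix.inv_eq_right_inv hinv
  have hconj : c • mixer n = hadamard n *
      (Matrix.diagonal fun y => c * ∑ k, (sign (y k) : ℂ)) * (hadamard n)⁻¹ := by
    have hd : (Matrix.diagonal fun y : Basis n => c * ∑ k, (sign (y k) : ℂ)) =
        c • Matrix.diagonal fun y : Basis n => ∑ k, (sign (y k) : ℂ) := by
      rw [← Matrix.diagonal_smul]; rfl
    rw [hd, Matrix.mul_smul, ← mixer_mul_hadamard, Matrix.smul_mul, Matrix.mul_assoc, hinv', hinv,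
      Matrix.mul_one]
  rw [hconj, Matrix.exp_conj _ _ hU, Matrix.exp_diagonal, hinv', Matrix.mul_smul,
    Matrix.smul_apply, Matrix.mul_apply]
  have hexp : ∀ z : Basis n, NormedSpace.exp (fun y : Basis n => c * ∑ k, (sign (y k) : ℂ)) z =
      ∏ k, Complex.exp (c * sign (z k)) := by
    intro z
    rw [Pi.coe_exp, ← Complex.exp_eq_exp_ℂ, Finset.mul_sum, Complex.exp_sum]
  simp only [Matrix.mul_diagonal, hexp, hadamard, Matrix.of_apply, ← Finset.prod_mul_distrib]
  rw [← prod_sum_bool fun k b => hadamardFactor (x k) b * Complex.exp (c * sign b) *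
    hadamardFactor b (y k)]
  have h3 : (2 ^ n : ℂ)⁻¹ = ∏ _k : Fin n, (2 : ℂ)⁻¹ := by simp
  rw [h3, smul_eq_mul, ← Finset.prod_mul_distrib]
  refine Finset.prod_congr rfl fun k _ => ?_
  cases x k <;> cases y k <;>
    simp [hadamardFactor, sign, Complex.cosh, Complex.sinh] <;> ring

theorem exp_neg_I_smul_mixer (n : ℕ) (b : ℝ) (x y : Basis n) :
    NormedSpace.exp ((-Complex.I * ((b / 2 : ℝ) : ℂ)) • mixer n) x y =
      ∏ k, star (mixFactor b (x k) (y k)) := by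
  rw [exp_smul_mixer]
  refine Finset.prod_congr rfl fun k _ => ?_
  have h1 : -Complex.I * ((b / 2 : ℝ) : ℂ) = -(((b / 2 : ℝ) : ℂ) * Complex.I) := by ring
  rw [h1, Complex.cosh_neg, Complex.sinh_neg, Complex.cosh_mul_I, Complex.sinh_mul_I, mixFactor]
  split_ifs
  · rw [Complex.star_def, Complex.conj_ofReal, Complex.ofReal_cos]
  · rw [Complex.star_def, map_mul, Complex.conj_I, Complex.conj_ofReal, Complex.ofReal_sin]
    ring

/-- The energy `∑_{k < l} J_{kl} z_k z_l` of a spin configuration. -/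
def spinEnergy {n : ℕ} (J : Pairs n → ℝ) (x : Basis n) : ℝ :=
  ∑ e : Pairs n, J e * (sign (x e.1.1) * sign (x e.1.2))

theorem hamiltonian_eq_diagonal {n : ℕ} (J : Pairs n → ℝ) :
    hamiltonian J = Matrix.diagonal fun x => (spinEnergy J x : ℂ) := by
  ext x y
  simp only [hamiltonian, pauliZ, Matrix.diagonal_mul_diagonal, Matrix.sum_apply,
    Matrix.smul_apply, Matrix.diagonal_apply, spinEnergy]
  split_ifs with h
  · push_cast; simp
  · simp

theorem exp_smul_hamiltonian {n : ℕ} (J : Pairs n → ℝ) (c : ℂ) :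
    NormedSpace.exp (c • hamiltonian J) =
      Matrix.diagonal fun x => Complex.exp (c * spinEnergy J x) := by
  rw [hamiltonian_eq_diagonal, ← Matrix.diagonal_smul, Matrix.exp_diagonal]
  congr 1
  funext x
  rw [Pi.coe_exp, ← Complex.exp_eq_exp_ℂ]
  rfl

theorem qaoaLayer_apply {n : ℕ} (J : Pairs n → ℝ) (b g : ℝ) (ψ : Basis n → ℂ) (y : Basis n) :
    qaoaLayer J b g ψ y = ∑ x, (∏ k, star (mixFactor b (y k) (x k))) *
      (Complex.exp (-Complex.I * ((g / 2 : ℝ) : ℂ) * spinEnergy J x) * ψ x) := by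
  unfold qaoaLayer
  rw [exp_smul_hamiltonian, Matrix.mulVec, dotProduct]
  refine Finset.sum_congr rfl fun x _ => ?_
  rw [Matrix.mulVec_diagonal, exp_neg_I_smul_mixer]

/-- The amplitude of the path `z_0, …, z_{p-1}, y` of spin configurations. -/
def pathAmplitude {n p : ℕ} (J : Pairs n → ℝ) (β γ : Fin p → ℝ) (z : Fin p → Basis n)
    (y : Basis n) : ℂ :=
  ∏ j : Fin p, (∏ k, star (mixFactor (β j)
      ((Fin.snoc z y : Fin (p + 1) → Basis n) j.succ k)
      ((Fin.snoc z y : Fin (p + 1) → Basis n) j.castSucc k))) *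
    Complex.exp (-Complex.I * ((γ j / 2 : ℝ) : ℂ) * spinEnergy J (z j))

theorem qaoaState_succ {n p : ℕ} (J : Pairs n → ℝ) (β γ : Fin (p + 1) → ℝ) :
    qaoaState J β γ = qaoaLayer J (β (Fin.last p)) (γ (Fin.last p))
      (qaoaState J (fun j => β j.castSucc) (fun j => γ j.castSucc)) := by
  unfold qaoaState
  rw [List.finRange_succ_last, List.foldl_append, List.foldl_map]
  rfl

theorem pathAmplitude_snoc {n p : ℕ} (J : Pairs n → ℝ) (β γ : Fin (p + 1) → ℝ)
    (z : Fin p → Basis n) (x y : Basis n) :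
    pathAmplitude J β γ (Fin.snoc z x : Fin (p + 1) → Basis n) y =
      pathAmplitude J (fun j => β j.castSucc) (fun j => γ j.castSucc) z x *
        ((∏ k, star (mixFactor (β (Fin.last p)) (y k) (x k))) *
          Complex.exp (-Complex.I * ((γ (Fin.last p) / 2 : ℝ) : ℂ) * spinEnergy J x)) := by
  unfold pathAmplitude
  rw [Fin.prod_univ_castSucc]
  congr 1
  · refine Finset.prod_congr rfl fun j _ => ?_
    simp only [Fin.succ_castSucc, Fin.snoc_castSucc]
  · simp only [Fin.succ_last, Fin.snoc_last, Fin.snoc_castSucc]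

theorem qaoaState_apply {n p : ℕ} (J : Pairs n → ℝ) (β γ : Fin p → ℝ) (y : Basis n) :
    qaoaState J β γ y = ((1 / Real.sqrt 2 : ℝ) : ℂ) ^ n *
      ∑ z : Fin p → Basis n, pathAmplitude J β γ z y := by
  induction p generalizing y with
  | zero => simp [qaoaState, plusState, pathAmplitude]
  | succ p ih =>
    rw [qaoaState_succ, qaoaLayer_apply,
      ← (Fin.snocEquiv fun _ : Fin (p + 1) => Basis n).sum_comp, Fintype.sum_prod_type,
      Finset.mul_sum]
    refine Finset.sum_congr rfl fun x _ => ?_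
    rw [ih]
    simp only [Fin.snocEquiv, Equiv.coe_fn_mk, pathAmplitude_snoc]
    rw [← Finset.sum_mul]
    ring

/-- The energy per spin as an average over spin configurations. -/
theorem qaoaEnergyPerSpin_eq_sum {n p : ℕ} (J : Pairs n → ℝ) (β γ : Fin p → ℝ) :
    qaoaEnergyPerSpin β γ J =
      ∑ y, star (qaoaState J β γ y) * ((n : ℂ)⁻¹ * spinEnergy J y * qaoaState J β γ y) := by
  unfold qaoaEnergyPerSpin
  rw [hamiltonian_eq_diagonal, ← Matrix.diagonal_smul, dotProduct]
  refine Finset.sum_congr rfl fun y _ => ?_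
  rw [Matrix.mulVec_diagonal]
  rfl

theorem star_qaoaEnergyPerSpin {n p : ℕ} (J : Pairs n → ℝ) (β γ : Fin p → ℝ) :
    (starRingEnd ℂ) (qaoaEnergyPerSpin β γ J) = qaoaEnergyPerSpin β γ J := by
  rw [qaoaEnergyPerSpin_eq_sum, map_sum]
  refine Finset.sum_congr rfl fun y _ => ?_
  simp only [map_mul, map_inv₀, Complex.conj_natCast, Complex.conj_ofReal, Complex.star_def,
    Complex.conj_conj]
  ring

/-- A family of bitstrings, one for each qubit, as a path of spin configurations for the ket, the
final configuration, and a path for the bra. -/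
def bitsEquiv (n p : ℕ) :
    (Fin n → Bits p) ≃ (Fin p → Basis n) × Basis n × (Fin p → Basis n) where
  toFun u := (fun j k => u k ⟨j, by omega⟩, fun k => center (u k),
    fun j k => u k ⟨2 * p - j, by omega⟩)
  invFun r := fun k i =>
    if h : (i : ℕ) < p then r.1 ⟨i, h⟩ k
    else if h' : (i : ℕ) = p then r.2.1 k
    else r.2.2 ⟨2 * p - i, by omega⟩ k
  left_inv u := by
    funext k i
    have hi := i.2
    by_cases h : (i : ℕ) < p
    · simp only [dif_pos h]
    · by_cases h' : (i : ℕ) = p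
      · simp only [dif_neg h, dif_pos h', center]
        congr 1
        ext; exact h'.symm
      · simp only [dif_neg h, dif_neg h']
        congr 1
        ext; simp only; omega
  right_inv r := by
    obtain ⟨z, y, w⟩ := r
    refine Prod.ext ?_ (Prod.ext ?_ ?_)
    · funext j k
      simp [j.2]
    · funext k
      simp [center]
    · funext j k
      have hj := j.2
      have h1 : ¬ 2 * p - (j : ℕ) < p := by omega
      have h2 : ¬ 2 * p - (j : ℕ) = p := by omega
      simp only [dif_neg h1, dif_neg h2]
      congr 1
      ext; simp only; omega

/-- The factor is imaginary exactly when the bits differ, so conjugation is a product of bit signs;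
along a path these telescope. -/
theorem star_mixFactor (b : ℝ) (x y : Bool) :
    star (mixFactor b x y) = (sign x * sign y : ℂ) * mixFactor b x y := by
  rw [Complex.star_def]
  cases x <;> cases y <;>
    simp [mixFactor, sign, Complex.conj_ofReal, -Complex.ofReal_cos, -Complex.ofReal_sin]

theorem mixFactor_comm (b : ℝ) (x y : Bool) : mixFactor b x y = mixFactor b y x := by
  unfold mixFactor; simp only [eq_comm]

theorem prod_sign_telescope (p : ℕ) (h : Fin (p + 1) → Bool) :
    ∏ j : Fin p, (sign (h j.succ) * sign (h j.castSucc)) = sign (h 0) * sign (h (Fin.last p)) := by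
  induction p with
  | zero => simp [sign_mul_self]
  | succ p ih =>
    rw [Fin.prod_univ_castSucc]
    have := ih fun i => h i.castSucc
    simp only [Fin.succ_castSucc, Fin.succ_last, Fin.castSucc_zero] at this ⊢
    rw [this, mul_comm (sign (h (Fin.last (p + 1)))), mul_assoc,
      ← mul_assoc (sign (h (Fin.last p).castSucc)), sign_mul_self, one_mul]

theorem oddSign_eq {p : ℕ} (s : Bits p) : oddSign s = sign (s 0) * sign (center s) := by
  have h : oddSign s = if s 0 = center s then 1 else -1 := by
    unfold oddSign
    by_cases h : s 0 = center s <;> simp [IsOdd, h]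
  rw [h]
  generalize s 0 = a
  generalize center s = b
  cases a <;> cases b <;> simp [sign]

theorem snoc_ket {n p : ℕ} (u : Fin n → Bits p) (i : Fin (p + 1)) (k : Fin n) :
    (Fin.snoc (bitsEquiv n p u).1 (bitsEquiv n p u).2.1 : Fin (p + 1) → Basis n) i k =
      u k ⟨i, by omega⟩ := by
  refine Fin.lastCases ?_ (fun j => ?_) i
  · rw [Fin.snoc_last]; rfl
  · rw [Fin.snoc_castSucc]; rfl

theorem snoc_bra {n p : ℕ} (u : Fin n → Bits p) (i : Fin (p + 1)) (k : Fin n) :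
    (Fin.snoc (bitsEquiv n p u).2.2 (bitsEquiv n p u).2.1 : Fin (p + 1) → Basis n) i k =
      u k ⟨2 * p - i, by omega⟩ := by
  refine Fin.lastCases ?_ (fun j => ?_) i
  · rw [Fin.snoc_last]
    change u k ⟨p, _⟩ = _
    congr 1
    ext; simp only [Fin.val_last]; omega
  · rw [Fin.snoc_castSucc]; rfl

/-- The mixers of the ket carry conjugated factors and those of the bra do not. Undoing the
conjugation along the ket half produces signs that telescope to (-1)^{s_0 + s_p} = ε_s. The phases
give bra minus ket, which is φ because signs turn XOR into a product. -/
theorem pathAmplitude_mul_star {n p : ℕ} (J : Pairs n → ℝ) (β γ : Fin p → ℝ)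
    (u : Fin n → Bits p) :
    pathAmplitude J β γ (bitsEquiv n p u).1 (bitsEquiv n p u).2.1 *
      star (pathAmplitude J β γ (bitsEquiv n p u).2.2 (bitsEquiv n p u).2.1) =
    (∏ k, (oddSign (u k) : ℂ) * bCoeff β (u k)) *
      ∏ e : Pairs n, Complex.exp (Complex.I * (J e * phase γ (bxor (u e.1.1) (u e.1.2)) : ℝ)) := by
  unfold pathAmplitude
  simp only [Finset.prod_mul_distrib, snoc_ket, snoc_bra, star_mul', star_prod, star_star,
    Fin.val_castSucc, Fin.val_succ]
  have hmix : (∏ j : Fin p, ∏ k, star (mixFactor (β j) (u k ⟨j + 1, by omega⟩)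
        (u k ⟨j, by omega⟩))) *
      (∏ j : Fin p, ∏ k, mixFactor (β j) (u k ⟨2 * p - (j + 1), by omega⟩)
        (u k ⟨2 * p - j, by omega⟩)) =
      (∏ k, (oddSign (u k) : ℂ)) * ∏ k, bCoeff β (u k) := by
    rw [Finset.prod_comm, ← Finset.prod_mul_distrib]
    rw [Finset.prod_comm (f := fun (j : Fin p) (k : Fin n) => mixFactor (β j)
      (u k ⟨2 * p - (j + 1), by omega⟩) (u k ⟨2 * p - j, by omega⟩)), ← Finset.prod_mul_distrib]
    refine Finset.prod_congr rfl fun k _ => ?_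
    have htel := prod_sign_telescope p fun i => u k ⟨i, by omega⟩
    have hodd : (oddSign (u k) : ℂ) = ∏ j : Fin p,
        (sign (u k ⟨j + 1, by omega⟩) * sign (u k ⟨j, by omega⟩) : ℂ) := by
      rw [oddSign_eq]
      exact_mod_cast htel.symm
    rw [hodd, bCoeff, ← Finset.prod_mul_distrib, ← Finset.prod_mul_distrib]
    refine Finset.prod_congr rfl fun j _ => ?_
    rw [star_mixFactor, mixFactor_comm _ (u k ⟨j + 1, _⟩), mixFactor_comm _ (u k ⟨2 * p - (j + 1), _⟩)]
    have : (⟨2 * p - j - 1, by omega⟩ : Fin (2 * p + 1)) = ⟨2 * p - (j + 1), by omega⟩ := by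
      ext; simp only; omega
    rw [this]
    ring
  have hph : (∏ j : Fin p, Complex.exp (-Complex.I * ((γ j / 2 : ℝ) : ℂ) *
        spinEnergy J ((bitsEquiv n p u).1 j))) *
      (∏ j : Fin p, star (Complex.exp (-Complex.I * ((γ j / 2 : ℝ) : ℂ) *
        spinEnergy J ((bitsEquiv n p u).2.2 j)))) =
      ∏ e : Pairs n, Complex.exp (Complex.I *
        (J e * phase γ (bxor (u e.1.1) (u e.1.2)) : ℝ)) := by
    have hstar : ∀ j, star (Complex.exp (-Complex.I * ((γ j / 2 : ℝ) : ℂ) *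
        spinEnergy J ((bitsEquiv n p u).2.2 j))) = Complex.exp (Complex.I * ((γ j / 2 : ℝ) : ℂ) *
        spinEnergy J ((bitsEquiv n p u).2.2 j)) := by
      intro j
      rw [Complex.star_def, ← Complex.exp_conj]
      simp only [map_mul, map_neg, Complex.conj_I, Complex.conj_ofReal, neg_neg]
    rw [Finset.prod_congr rfl fun j _ => hstar j, ← Complex.exp_sum, ← Complex.exp_sum,
      ← Complex.exp_sum, ← Complex.exp_add, ← Finset.sum_add_distrib]
    congr 1
    have hreal : ∑ j : Fin p, γ j / 2 * (spinEnergy J ((bitsEquiv n p u).2.2 j) -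
        spinEnergy J ((bitsEquiv n p u).1 j)) =
        ∑ e : Pairs n, J e * phase γ (bxor (u e.1.1) (u e.1.2)) := by
      simp only [spinEnergy, phase, ← Finset.sum_sub_distrib, Finset.mul_sum]
      rw [Finset.sum_comm]
      refine Finset.sum_congr rfl fun e _ => Finset.sum_congr rfl fun j _ => ?_
      simp only [bxor, sign_xor]
      change γ j / 2 * (J e * (sign (u e.1.1 ⟨2 * p - j, _⟩) * sign (u e.1.2 ⟨2 * p - j, _⟩)) -
        J e * (sign (u e.1.1 ⟨j, _⟩) * sign (u e.1.2 ⟨j, _⟩))) = _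
      ring
    rw [← Finset.mul_sum, ← Complex.ofReal_sum, ← hreal, Complex.ofReal_sum, Finset.mul_sum]
    refine Finset.sum_congr rfl fun j _ => ?_
    push_cast
    ring
  rw [← hmix, ← hph]
  ring

theorem qaoaEnergyPerSpin_eq_path_sum {n p : ℕ} (J : Pairs n → ℝ) (β γ : Fin p → ℝ) :
    qaoaEnergyPerSpin β γ J = ∑ u : Fin n → Bits p, ∑ e : Pairs n,
      (1 / 2) ^ n * (n : ℂ)⁻¹ * (∏ k, (oddSign (u k) : ℂ) * bCoeff β (u k)) *
        (sign (center (u e.1.1)) * sign (center (u e.1.2)) : ℂ) *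
        ((J e : ℂ) * ∏ e' : Pairs n, Complex.exp (Complex.I *
          (J e' * phase γ (bxor (u e'.1.1) (u e'.1.2)) : ℝ))) := by
  have hc : ((1 / Real.sqrt 2 : ℝ) : ℂ) ^ n * ((1 / Real.sqrt 2 : ℝ) : ℂ) ^ n = (1 / 2) ^ n := by
    rw [← mul_pow, ← Complex.ofReal_mul, div_mul_div_comm, Real.mul_self_sqrt (by norm_num)]
    norm_num
  have hstarc : star (((1 / Real.sqrt 2 : ℝ) : ℂ) ^ n) = ((1 / Real.sqrt 2 : ℝ) : ℂ) ^ n := by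
    rw [Complex.star_def, map_pow, Complex.conj_ofReal]
  rw [qaoaEnergyPerSpin_eq_sum]
  have h1 : ∀ y, star (qaoaState J β γ y) * ((n : ℂ)⁻¹ * spinEnergy J y * qaoaState J β γ y) =
      ∑ z : Fin p → Basis n, ∑ w : Fin p → Basis n, (1 / 2) ^ n * (n : ℂ)⁻¹ * spinEnergy J y *
        (pathAmplitude J β γ z y * star (pathAmplitude J β γ w y)) := by
    intro y
    simp only [← Finset.mul_sum]
    rw [← Finset.sum_mul, ← star_sum, qaoaState_apply, star_mul', hstarc, ← hc]
    ring
  rw [Finset.sum_congr rfl fun y _ => h1 y, Finset.sum_comm]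
  have h2 : ∀ F : (Fin p → Basis n) → Basis n → (Fin p → Basis n) → ℂ,
      ∑ z, ∑ y, ∑ w, F z y w = ∑ u, F (bitsEquiv n p u).1 (bitsEquiv n p u).2.1
        (bitsEquiv n p u).2.2 := by
    intro F
    rw [(bitsEquiv n p).sum_comp fun r => F r.1 r.2.1 r.2.2, Fintype.sum_prod_type]
    simp only [Fintype.sum_prod_type]
  rw [h2 fun z y w => (1 / 2) ^ n * (n : ℂ)⁻¹ * spinEnergy J y *
        (pathAmplitude J β γ z y * star (pathAmplitude J β γ w y))]
  refine Finset.sum_congr rfl fun u _ => ?_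
  rw [pathAmplitude_mul_star, spinEnergy]
  push_cast
  rw [Finset.mul_sum, Finset.sum_mul]
  refine Finset.sum_congr rfl fun e _ => ?_
  simp only [bitsEquiv, Equiv.coe_fn_mk]
  ring

end PathSum

/-! ### Averages over the couplings -/

section GaussianAverage

theorem integral_gaussian_exp (n : ℕ) (f : ℝ) :
    ∫ x, Complex.exp (Complex.I * (x * f : ℝ)) ∂gaussianReal 0 (n : NNReal)⁻¹ =
      (Real.exp (-f ^ 2 / (2 * n)) : ℂ) := by
  have h := charFun_gaussianReal (μ := 0) (v := (n : NNReal)⁻¹) f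
  rw [charFun_apply_real] at h
  convert h using 1
  · congr 1
    funext x
    congr 1
    push_cast
    ring
  · push_cast
    congr 1
    simp only [mul_zero, zero_mul, zero_sub]
    rw [mul_comm (2 : ℂ), ← div_div]
    ring

/-- The derivative of the complex moment generating function e^{v z² / 2} at z = i f, with v = 1/n.
-/
theorem integral_gaussian_mul_exp (n : ℕ) (f : ℝ) :
    ∫ x, (x : ℂ) * Complex.exp (Complex.I * (x * f : ℝ)) ∂gaussianReal 0 (n : NNReal)⁻¹ =
      Complex.I * f / n * (Real.exp (-f ^ 2 / (2 * n)) : ℂ) := by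
  set v : NNReal := (n : NNReal)⁻¹ with hv
  have h1 : HasDerivAt (complexMGF id (gaussianReal 0 v))
      (∫ x, ((id x : ℝ) : ℂ) * Complex.exp ((Complex.I * f) * (id x : ℝ)) ∂gaussianReal 0 v)
      (Complex.I * f) := by
    apply hasDerivAt_complexMGF
    rw [integrableExpSet_id_gaussianReal, interior_univ]
    trivial
  have h2 : complexMGF id (gaussianReal 0 v) = fun z : ℂ => Complex.exp (v * z ^ 2 / 2) := by
    funext z
    rw [complexMGF_id_gaussianReal]
    congr 1
    push_cast; ring
  rw [h2] at h1
  have h3 : HasDerivAt (fun z : ℂ => Complex.exp (v * z ^ 2 / 2))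
      (Complex.exp (v * (Complex.I * f) ^ 2 / 2) * (v * (2 * (Complex.I * f)) / 2))
      (Complex.I * f) := by
    have := (((hasDerivAt_pow 2 (Complex.I * (f : ℂ))).const_mul (v : ℂ)).div_const 2).cexp
    simpa using this
  have h4 := h1.unique h3
  have h5 : ∫ x, (x : ℂ) * Complex.exp (Complex.I * (x * f : ℝ)) ∂gaussianReal 0 v =
      ∫ x, ((id x : ℝ) : ℂ) * Complex.exp ((Complex.I * f) * (id x : ℝ)) ∂gaussianReal 0 v := by
    congr 1
    funext x
    simp only [id]
    congr 2
    push_cast; ring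
  have hv' : ((v : ℝ) : ℂ) = (n : ℂ)⁻¹ := by rw [hv]; push_cast; rfl
  rw [h5, h4, mul_pow, Complex.I_sq, hv']
  have h6 : Complex.exp ((n : ℂ)⁻¹ * (-1 * (f : ℂ) ^ 2) / 2) =
      (Real.exp (-f ^ 2 / (2 * n)) : ℂ) := by
    push_cast
    congr 1
    rw [mul_comm (2 : ℂ), ← div_div]
    ring
  rw [h6]
  ring

theorem norm_exp_I_mul (x : ℝ) : ‖Complex.exp (Complex.I * (x : ℂ))‖ = 1 := by
  rw [mul_comm, Complex.norm_exp_ofReal_mul_I]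

/-- The integrand attached to the pair `e'` when the energy of the pair `e` is measured. -/
def pairIntegrand {n : ℕ} (f : Pairs n → ℝ) (e e' : Pairs n) (x : ℝ) : ℂ :=
  (if e' = e then (x : ℂ) else 1) * Complex.exp (Complex.I * (x * f e' : ℝ))

theorem prod_pairIntegrand {n : ℕ} (f : Pairs n → ℝ) (e : Pairs n) (J : Pairs n → ℝ) :
    ∏ e', pairIntegrand f e e' (J e') =
      (J e : ℂ) * ∏ e', Complex.exp (Complex.I * (J e' * f e' : ℝ)) := by
  simp only [pairIntegrand, Finset.prod_mul_distrib]
  simp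

theorem integrable_pairIntegrand {n : ℕ} (f : Pairs n → ℝ) (e e' : Pairs n) :
    Integrable (pairIntegrand f e e') (gaussianReal 0 (n : NNReal)⁻¹) := by
  unfold pairIntegrand
  split_ifs
  · have h : Integrable (fun x : ℝ => x) (gaussianReal 0 (n : NNReal)⁻¹) :=
      (memLp_id_gaussianReal 1).integrable le_rfl
    refine h.mono (by fun_prop) (.of_forall fun x => ?_)
    rw [norm_mul, norm_exp_I_mul, mul_one, Complex.norm_real]
  · refine Integrable.of_bound (C := 1) (by fun_prop) (.of_forall fun x => ?_)
    rw [one_mul, norm_exp_I_mul]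

theorem integrable_skMeasure {n : ℕ} (f : Pairs n → ℝ) (e : Pairs n) :
    Integrable (fun J : Pairs n → ℝ =>
      (J e : ℂ) * ∏ e', Complex.exp (Complex.I * (J e' * f e' : ℝ))) (skMeasure n) := by
  simp only [← prod_pairIntegrand]
  exact Integrable.fintype_prod fun e' => integrable_pairIntegrand f e e'

theorem integral_skMeasure {n : ℕ} (f : Pairs n → ℝ) (e : Pairs n) :
    ∫ J : Pairs n → ℝ, (J e : ℂ) * ∏ e', Complex.exp (Complex.I * (J e' * f e' : ℝ))
      ∂skMeasure n =
    Complex.I * f e / n * ∏ e' : Pairs n, (Real.exp (-(f e') ^ 2 / (2 * n)) : ℂ) := by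
  simp only [← prod_pairIntegrand]
  rw [skMeasure, integral_fintype_prod_eq_prod]
  have h : ∀ e', ∫ x, pairIntegrand f e e' x ∂gaussianReal 0 (n : NNReal)⁻¹ =
      (if e' = e then Complex.I * f e / n else 1) *
        (Real.exp (-(f e') ^ 2 / (2 * n)) : ℂ) := by
    intro e'
    unfold pairIntegrand
    split_ifs with h
    · subst h; exact integral_gaussian_mul_exp n _
    · simp only [one_mul]; exact integral_gaussian_exp n _
  rw [Finset.prod_congr rfl fun e' _ => h e', Finset.prod_mul_distrib]
  simp

variable {n p : ℕ}

theorem integrable_qaoaEnergyPerSpin (β γ : Fin p → ℝ) :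
    Integrable (qaoaEnergyPerSpin (n := n) β γ) (skMeasure n) := by
  have : qaoaEnergyPerSpin (n := n) β γ = fun J => _ :=
    funext fun J => qaoaEnergyPerSpin_eq_path_sum J β γ
  rw [this]
  refine integrable_finsetSum _ fun u _ => integrable_finsetSum _ fun e _ => ?_
  exact (integrable_skMeasure (fun e : Pairs n => phase γ (bxor (u e.1.1) (u e.1.2))) e).const_mul _

theorem integral_qaoaEnergyPerSpin (β γ : Fin p → ℝ) :
    ∫ J, qaoaEnergyPerSpin β γ J ∂skMeasure n = ∑ u : Fin n → Bits p, ∑ e : Pairs n,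
      (1 / 2) ^ n * (n : ℂ)⁻¹ * (∏ k, (oddSign (u k) : ℂ) * bCoeff β (u k)) *
        (sign (center (u e.1.1)) * sign (center (u e.1.2)) : ℂ) *
        (Complex.I * phase γ (bxor (u e.1.1) (u e.1.2)) / n *
          ∏ e' : Pairs n, dampC n γ (u e'.1.1) (u e'.1.2)) := by
  have hint : ∀ (u : Fin n → Bits p) (e : Pairs n), Integrable (fun J : Pairs n → ℝ =>
      (1 / 2) ^ n * (n : ℂ)⁻¹ * (∏ k, (oddSign (u k) : ℂ) * bCoeff β (u k)) *
        (sign (center (u e.1.1)) * sign (center (u e.1.2)) : ℂ) *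
        ((J e : ℂ) * ∏ e' : Pairs n, Complex.exp (Complex.I *
          (J e' * phase γ (bxor (u e'.1.1) (u e'.1.2)) : ℝ)))) (skMeasure n) := fun u e =>
    (integrable_skMeasure (fun e : Pairs n => phase γ (bxor (u e.1.1) (u e.1.2))) e).const_mul _
  simp only [qaoaEnergyPerSpin_eq_path_sum]
  rw [integral_finsetSum _ fun u _ => integrable_finsetSum _ fun e _ => hint u e]
  refine Finset.sum_congr rfl fun u _ => ?_
  rw [integral_finsetSum _ fun e _ => hint u e]
  refine Finset.sum_congr rfl fun e _ => ?_
  rw [integral_const_mul,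
    integral_skMeasure (fun e : Pairs n => phase γ (bxor (u e.1.1) (u e.1.2))) e]
  rfl

end GaussianAverage

/-! ### Symmetrisation over the qubits -/

section Symmetrisation

variable {n p : ℕ}

theorem sum_pairs_eq {M : Type*} [Field M] [CharZero M] (g : Fin n → Fin n → M)
    (hg : ∀ i j, g i j = g j i) (h0 : ∀ i, g i i = 0) :
    ∑ e : Pairs n, g e.1.1 e.1.2 = 1 / 2 * ∑ i, ∑ j, g i j := by
  have h1 : ∑ e : Pairs n, g e.1.1 e.1.2 = ∑ i, ∑ j, if i < j then g i j else 0 := by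
    rw [← Fintype.sum_prod_type' (f := fun i j => if i < j then g i j else 0),
      ← Finset.sum_filter, Finset.sum_subtype (p := fun e : Fin n × Fin n => e.1 < e.2)]
    simp
  have h2 : ∑ i, ∑ j, (if j < i then g i j else 0) = ∑ i, ∑ j, if i < j then g i j else 0 := by
    rw [Finset.sum_comm]
    exact Finset.sum_congr rfl fun i _ => Finset.sum_congr rfl fun j _ => by rw [hg]
  have h3 : ∑ i, ∑ j, g i j = (∑ i, ∑ j, if i < j then g i j else 0) +
      ∑ i, ∑ j, if j < i then g i j else 0 := by
    simp only [← Finset.sum_add_distrib]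
    refine Finset.sum_congr rfl fun i _ => Finset.sum_congr rfl fun j _ => ?_
    rcases lt_trichotomy i j with h | h | h
    · simp [h, h.not_gt]
    · subst h; simp [h0]
    · simp [h, h.not_gt]
  rw [h1, h3, h2]
  ring

/-- The interaction of a family of strings, in a form that does not refer to an order. -/
def gibbsFactor (n : ℕ) (γ : Fin p → ℝ) {N : ℕ} (u : Fin N → Bits p) : ℝ :=
  Real.exp (-(1 / 2 * ∑ i, ∑ j, phase γ (bxor (u i) (u j)) ^ 2) / (2 * n))

theorem prod_pairs_dampC (γ : Fin p → ℝ) (u : Fin n → Bits p) :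
    ∏ e : Pairs n, dampC n γ (u e.1.1) (u e.1.2) = (gibbsFactor n γ u : ℂ) := by
  unfold dampC gibbsFactor
  rw [← Complex.ofReal_prod, ← sum_pairs_eq (fun i j => phase γ (bxor (u i) (u j)) ^ 2)
    (fun i j => by rw [bxor_comm]) (fun i => by rw [phase_bxor_self]; ring)]
  simp only [damp]
  rw [← Real.exp_sum, neg_div, Finset.sum_div, ← Finset.sum_neg_distrib]
  simp only [neg_div]

theorem gibbsFactor_comp_perm (m : ℕ) (γ : Fin p → ℝ) {N : ℕ} (u : Fin N → Bits p)
    (σ : Equiv.Perm (Fin N)) : gibbsFactor m γ (u ∘ σ) = gibbsFactor m γ u := by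
  unfold gibbsFactor
  simp only [Function.comp_apply]
  rw [Equiv.sum_comp σ fun i => ∑ j, phase γ (bxor (u i) (u (σ j))) ^ 2]
  congr 4
  refine Finset.sum_congr rfl fun i _ => ?_
  rw [Equiv.sum_comp σ fun j => phase γ (bxor (u i) (u j)) ^ 2]

theorem gibbsFactor_cons (m : ℕ) (γ : Fin p → ℝ) {N : ℕ} (x : Bits p) (u : Fin N → Bits p) :
    (gibbsFactor m γ (Fin.cons x u : Fin (N + 1) → Bits p) : ℂ) =
      (∏ i, dampC m γ x (u i)) * gibbsFactor m γ u := by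
  unfold gibbsFactor dampC
  rw [← Complex.ofReal_prod, ← Complex.ofReal_mul]
  congr 1
  simp only [damp, Fin.sum_univ_succ, Fin.cons_zero, Fin.cons_succ, phase_bxor_self,
    Finset.sum_add_distrib]
  rw [← Real.exp_sum, ← Real.exp_add]
  congr 1
  simp only [neg_div, Finset.sum_neg_distrib, ← Finset.sum_div, bxor_comm _ x]
  ring

/-- Links the permutation-invariant form, used for the symmetry between qubits, with the recursive
form, used for the elimination. -/
theorem sum_gibbsFactor_eq_interactionSum (m : ℕ) (γ : Fin p → ℝ) (N : ℕ) (a : Bits p → ℂ) :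
    ∑ u : Fin N → Bits p, (∏ i, a (u i)) * gibbsFactor m γ u =
      interactionSum (dampC m γ) Finset.univ N a := by
  induction N generalizing a with
  | zero => simp [interactionSum, gibbsFactor]
  | succ N ih =>
    rw [← (Fin.consEquiv fun _ : Fin (N + 1) => Bits p).sum_comp, Fintype.sum_prod_type,
      interactionSum]
    refine Finset.sum_congr rfl fun x _ => ?_
    rw [← ih, Finset.mul_sum]
    refine Finset.sum_congr rfl fun u _ => ?_
    simp only [Fin.consEquiv, Equiv.coe_fn_mk]
    rw [gibbsFactor_cons, Fin.prod_univ_succ, Finset.prod_mul_distrib]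
    simp only [Fin.cons_zero, Fin.cons_succ]
    ring

/-- The contribution of the pair `(k, l)` to the energy. -/
def pairContribution (n : ℕ) (β γ : Fin p → ℝ) {N : ℕ} (k l : Fin N) : ℂ :=
  ∑ u : Fin N → Bits p, (∏ i, (oddSign (u i) : ℂ) * bCoeff β (u i)) *
    (sign (center (u k)) * sign (center (u l)) * phase γ (bxor (u k) (u l)) : ℂ) *
      gibbsFactor n γ u

theorem pairContribution_perm (m : ℕ) (β γ : Fin p → ℝ) {N : ℕ} (k l : Fin N)
    (σ : Equiv.Perm (Fin N)) :
    pairContribution m β γ (σ k) (σ l) = pairContribution m β γ k l := by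
  unfold pairContribution
  rw [← (Equiv.arrowCongr σ (Equiv.refl (Bits p))).sum_comp]
  refine Finset.sum_congr rfl fun u _ => ?_
  have h : (Equiv.arrowCongr σ (Equiv.refl (Bits p))) u = u ∘ σ.symm := rfl
  rw [h, gibbsFactor_comp_perm]
  simp only [Function.comp_apply, Equiv.symm_apply_apply]
  rw [σ.symm.prod_comp fun i => (oddSign (u i) : ℂ) * bCoeff β (u i)]

theorem pairContribution_eq (m : ℕ) (β γ : Fin p → ℝ) {N : ℕ} {k l k' l' : Fin N}
    (h : k ≠ l) (h' : k' ≠ l') :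
    pairContribution m β γ k l = pairContribution m β γ k' l' := by
  obtain ⟨σ, hσ⟩ : ∃ σ : Equiv.Perm (Fin N), σ k' = k ∧ σ l' = l := by
    -- The first swap moves k' to k; the second moves the image of l' to l and fixes k, which
    -- differs from both.
    refine ⟨Equiv.swap (Equiv.swap k' k l') l * Equiv.swap k' k, ?_, ?_⟩
    · rw [Equiv.Perm.mul_apply, Equiv.swap_apply_left]
      refine Equiv.swap_apply_of_ne_of_ne (fun h1 => h' ?_) h
      exact (Equiv.swap k' k).injective (by rw [← h1, Equiv.swap_apply_left])
    · rw [Equiv.Perm.mul_apply, Equiv.swap_apply_left]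
  rw [← hσ.1, ← hσ.2, pairContribution_perm]

/-- The first two qubits carry s and t; each remaining qubit feels them through C_{s⊕x} C_{t⊕x},
absorbed into its site weight. -/
theorem pairContribution_zero_one (m : ℕ) (β γ : Fin p → ℝ) (N : ℕ) :
    pairContribution m β γ (0 : Fin (N + 2)) 1 = ∑ s : Bits p, ∑ t : Bits p,
      (sign (center s) * sign (center t) : ℂ) * bCoeff β s * bCoeff β t *
        (oddSign s : ℂ) * (oddSign t : ℂ) * (phase γ (bxor s t) : ℂ) *
        (dampC m γ s t * interactionSum (dampC m γ) Finset.univ N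
          fun x => (oddSign x : ℂ) * bCoeff β x * (dampC m γ s x * dampC m γ t x)) := by
  unfold pairContribution
  rw [← (Fin.consEquiv fun _ : Fin (N + 2) => Bits p).sum_comp, Fintype.sum_prod_type]
  refine Finset.sum_congr rfl fun s _ => ?_
  rw [← (Fin.consEquiv fun _ : Fin (N + 1) => Bits p).sum_comp, Fintype.sum_prod_type]
  refine Finset.sum_congr rfl fun t _ => ?_
  rw [← sum_gibbsFactor_eq_interactionSum, Finset.mul_sum, Finset.mul_sum]
  refine Finset.sum_congr rfl fun u _ => ?_
  simp only [Fin.consEquiv, Equiv.coe_fn_mk]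
  rw [gibbsFactor_cons, gibbsFactor_cons]
  have h1 : (1 : Fin (N + 2)) = Fin.succ 0 := rfl
  simp only [h1, Fin.prod_univ_succ, Fin.cons_zero, Fin.cons_succ, Finset.prod_mul_distrib]
  ring

theorem card_pairs (n : ℕ) : (Fintype.card (Pairs n) : ℂ) = n * (n - 1) / 2 := by
  have h := sum_pairs_eq (n := n) (fun i j => if i = j then (0 : ℂ) else 1)
    (fun i j => by simp only [eq_comm]) (fun i => by simp)
  have h1 : ∑ e : Pairs n, (if e.1.1 = e.1.2 then (0 : ℂ) else 1) = Fintype.card (Pairs n) := by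
    rw [Finset.sum_congr rfl fun e _ => if_neg e.2.ne]
    simp
  have h2 : ∀ i : Fin n, ∑ j, (if i = j then (0 : ℂ) else 1) = n - 1 := by
    intro i
    have : ∀ j, (if i = j then (0 : ℂ) else 1) = 1 - if i = j then 1 else 0 := by
      intro j; split_ifs <;> ring
    rw [Finset.sum_congr rfl fun j _ => this j, Finset.sum_sub_distrib]
    simp
  rw [← h1, h, Finset.sum_congr rfl fun i _ => h2 i]
  simp
  ring

/-- There are n(n-1)/2 equal pair terms, each with prefactor 2^{-n} i / n²; hence i/8 times
n(n-1)/n² times 2^{-(n-2)}. -/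
theorem integral_qaoaEnergyPerSpin_eq (hn : 2 ≤ n) (β γ : Fin p → ℝ) :
    ∫ J, qaoaEnergyPerSpin β γ J ∂skMeasure n =
      Complex.I / 8 * ∑ s : Bits p, ∑ t : Bits p,
        (sign (center s) * sign (center t) : ℂ) * bCoeff β s * bCoeff β t *
        (oddSign s : ℂ) * (oddSign t : ℂ) * (phase γ (bxor s t) : ℂ) *
        ((n.descFactorial 2 : ℂ) / (n : ℂ) ^ 2 * (damp n γ (bxor s t) : ℂ) *
          ((1 / 2) ^ (n - 2) * interactionSum (dampC n γ) Finset.univ (n - 2)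
            fun x => (oddSign x : ℂ) * bCoeff β x * (dampC n γ s x * dampC n γ t x))) := by
  obtain ⟨N, rfl⟩ : ∃ N, n = N + 2 := ⟨n - 2, by omega⟩
  rw [integral_qaoaEnergyPerSpin, Finset.sum_comm]
  have h1 : ∀ e : Pairs (N + 2), ∑ u : Fin (N + 2) → Bits p,
      (1 / 2) ^ (N + 2) * ((N + 2 : ℕ) : ℂ)⁻¹ *
        (∏ k, (oddSign (u k) : ℂ) * bCoeff β (u k)) *
        (sign (center (u e.1.1)) * sign (center (u e.1.2)) : ℂ) *
        (Complex.I * phase γ (bxor (u e.1.1) (u e.1.2)) / (N + 2 : ℕ) *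
          ∏ e' : Pairs (N + 2), dampC (N + 2) γ (u e'.1.1) (u e'.1.2)) =
      (1 / 2) ^ (N + 2) * (((N + 2 : ℕ) : ℂ)⁻¹) ^ 2 * Complex.I *
        pairContribution (N + 2) β γ (0 : Fin (N + 2)) 1 := by
    intro e
    have h01 : (0 : Fin (N + 2)) ≠ 1 := Fin.zero_ne_one
    rw [pairContribution_eq (N + 2) β γ h01 e.2.ne, pairContribution, Finset.mul_sum]
    refine Finset.sum_congr rfl fun u _ => ?_
    rw [prod_pairs_dampC]
    ring
  rw [Finset.sum_congr rfl fun e _ => h1 e, Finset.sum_const, Finset.card_univ, nsmul_eq_mul,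
    card_pairs, pairContribution_zero_one]
  simp only [Finset.mul_sum]
  refine Finset.sum_congr rfl fun s _ => Finset.sum_congr rfl fun t _ => ?_
  have hd : ((N + 2).descFactorial 2 : ℂ) = (N + 2 : ℕ) * (((N + 2 : ℕ) : ℂ) - 1) := by
    have : (N + 2).descFactorial 2 = (N + 2) * (N + 1) := by
      simp [Nat.descFactorial]; ring
    rw [this]; push_cast; ring
  rw [hd, Nat.add_sub_cancel, dampC, pow_add]
  ring

end Symmetrisation

/-! ### The energy sample -/

section EnergySample

variable {n p : ℕ}

/-- The coefficient of `M_{s, t}` in the energy sample. -/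
def sampleCoeff (β γ : Fin p → ℝ) (st : Bits p × Bits p) : ℂ :=
  Complex.I / 8 * ((sign (center st.1) * sign (center st.2) : ℂ) * bCoeff β st.1 * bCoeff β st.2 *
    (oddSign st.1 : ℂ) * (oddSign st.2 : ℂ) * (phase γ (bxor st.1 st.2) : ℂ))

theorem energyOfWeights_eq (β γ : Fin p → ℝ) (M : Bits p × Bits p → ℂ) :
    energyOfWeights β γ M = ∑ st, (sampleCoeff β γ st * M st).re := by
  unfold energyOfWeights sampleCoeff
  rw [← Complex.re_sum, Fintype.sum_prod_type]
  congr 1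
  simp only [Finset.mul_sum]
  exact Finset.sum_congr rfl fun s _ => Finset.sum_congr rfl fun t _ => by ring

theorem measurable_energyOfWeights (β γ : Fin p → ℝ) : Measurable (energyOfWeights β γ) := by
  have : energyOfWeights β γ = fun M => ∑ st, (sampleCoeff β γ st * M st).re :=
    funext (energyOfWeights_eq β γ)
  rw [this]
  refine Finset.measurable_sum _ fun st _ => ?_
  exact Complex.measurable_re.comp ((measurable_pi_apply st).const_mul _)

theorem norm_sampleCoeff (β γ : Fin p → ℝ) (st : Bits p × Bits p) :
    ‖sampleCoeff β γ st‖ =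
      1 / 8 * (‖bCoeff β st.1‖ * ‖bCoeff β st.2‖ * |phase γ (bxor st.1 st.2)|) := by
  have hs : ∀ b, ‖(sign b : ℂ)‖ = 1 := by intro b; cases b <;> simp [sign]
  have ho : ∀ s : Bits p, ‖(oddSign s : ℂ)‖ = 1 := by
    intro s; unfold oddSign; split_ifs <;> simp
  unfold sampleCoeff
  simp only [norm_mul, norm_div, hs, ho, Complex.norm_I, Complex.norm_real, Complex.norm_ofNat,
    one_mul, mul_one, Real.norm_eq_abs]

theorem memLp_re_mul_weight (hn : 0 < n) (β γ : Fin p → ℝ) {l : List (Bits p)} (hl : l.Nodup)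
    (c : ℂ) (st : Bits p × Bits p) :
    MemLp (fun z : ℂ => (c * z).re) 2 (weightLaw n β γ l st.1 st.2).toMeasure :=
  ((memLp_weightLaw hn β γ hl st.1 st.2).const_mul c).re

theorem isProbabilityMeasure_energySampleLaw (β γ : Fin p → ℝ) (l : List (Bits p)) :
    IsProbabilityMeasure (energySampleLaw n β γ l) :=
  Measure.isProbabilityMeasure_map (measurable_energyOfWeights β γ).aemeasurable

theorem memLp_energyOfWeights (hn : 0 < n) (β γ : Fin p → ℝ) {l : List (Bits p)}
    (hl : l.Nodup) : MemLp (energyOfWeights β γ) 2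
      (Measure.pi fun st : Bits p × Bits p => (weightLaw n β γ l st.1 st.2).toMeasure) := by
  have : energyOfWeights β γ = fun M => ∑ st, (sampleCoeff β γ st * M st).re :=
    funext (energyOfWeights_eq β γ)
  rw [this]
  refine memLp_finsetSum _ fun st _ => ?_
  exact (memLp_re_mul_weight hn β γ hl (sampleCoeff β γ st) st).comp_measurePreserving
    (measurePreserving_eval (fun st : Bits p × Bits p =>
      (weightLaw n β γ l st.1 st.2).toMeasure) st)

theorem memLp_energySampleLaw (hn : 0 < n) (β γ : Fin p → ℝ) {l : List (Bits p)}
    (hl : l.Nodup) : MemLp id 2 (energySampleLaw n β γ l) :=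
  (memLp_map_measure_iff measurable_id.aestronglyMeasurable
    (measurable_energyOfWeights β γ).aemeasurable).2 (memLp_energyOfWeights hn β γ hl)

theorem integral_energySampleLaw (hn : 2 ≤ n) (β γ : Fin p → ℝ) {l : List (Bits p)}
    (hl : IsOddList l) : ∫ x, x ∂energySampleLaw n β γ l =
      (∫ J, qaoaEnergyPerSpin β γ J ∂skMeasure n).re := by
  have hn0 : 0 < n := by omega
  have hint : ∀ st : Bits p × Bits p,
      Integrable (fun z : ℂ => z) (weightLaw n β γ l st.1 st.2).toMeasure := fun st =>
    (memLp_weightLaw hn0 β γ hl.nodup st.1 st.2).integrable one_le_two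
  rw [energySampleLaw, integral_map (f := fun x : ℝ => x) (measurable_energyOfWeights β γ).aemeasurable
    aestronglyMeasurable_id]
  simp only [energyOfWeights_eq]
  rw [integral_finsetSum _ fun st _ => ?_]
  · have h1 : ∀ st : Bits p × Bits p, ∫ M : Bits p × Bits p → ℂ, (sampleCoeff β γ st * M st).re
        ∂(Measure.pi fun st : Bits p × Bits p => (weightLaw n β γ l st.1 st.2).toMeasure) =
        (sampleCoeff β γ st * mean (weightLaw n β γ l st.1 st.2) id).re := by
      intro st
      rw [integral_comp_eval (μ := fun st : Bits p × Bits p =>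
          (weightLaw n β γ l st.1 st.2).toMeasure) (i := st)
          (f := fun z : ℂ => (sampleCoeff β γ st * z).re)
          (memLp_re_mul_weight hn0 β γ hl.nodup _ st).aestronglyMeasurable,
        ← integral_toMeasure_eq_mean _ id (hint st), ← integral_const_mul]
      exact integral_re ((hint st).const_mul _)
    rw [Finset.sum_congr rfl fun st _ => h1 st, ← Complex.re_sum,
      integral_qaoaEnergyPerSpin_eq hn]
    congr 1
    rw [Fintype.sum_prod_type]
    simp only [mean_weightLaw hn0 β γ hl, sampleCoeff, Finset.mul_sum, mul_assoc]
  · exact integrable_comp_eval (μ := fun st : Bits p × Bits p =>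
          (weightLaw n β γ l st.1 st.2).toMeasure) (i := st)
          (f := fun z : ℂ => (sampleCoeff β γ st * z).re)
          ((memLp_re_mul_weight hn0 β γ hl.nodup _ st).integrable one_le_two)

theorem variance_energySampleLaw_le (hn : 0 < n) (β γ : Fin p → ℝ) {l : List (Bits p)}
    (hl : IsOddList l) {w : Bits p → ℝ} (hw : ∀ t, ‖bCoeff β t‖ ≤ w t) :
    variance id (energySampleLaw n β γ l) ≤ varianceBound w β γ l := by
  set R := rHat w β γ l with hRdef
  have hgrow : ∀ x, growth β γ R l x ≤ R x := growth_le_rHat β γ hl hw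
  have hR0 : ∀ x, 0 ≤ R x := fun x => (growth_pos β γ R l x).le.trans (hgrow x)
  -- All amplification factors are at least 1, so the bound over the whole list implies the one over
  -- each tail.
  have hR : ∀ a u b, l = a ++ u :: b → growth β γ R b u ≤ R u := by
    intro a u b hab
    refine le_trans ?_ (hgrow u)
    have hsplit : growth β γ R l u = growth β γ R (a ++ [u]) u * growth β γ R b u := by
      rw [hab]; simp [growth, mul_assoc]
    rw [hsplit]
    refine le_mul_of_one_le_left (growth_pos _ _ _ _ _).le (List.one_le_prod fun y hy => ?_)
    obtain ⟨v, _, rfl⟩ := List.mem_map.1 hy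
    have h1 := hR0 v
    have h2 := phaseGap_nonneg γ u v
    exact Real.one_le_exp (by positivity)
  -- Independence of the weights makes the variances add.
  have hvar : variance id (energySampleLaw n β γ l) = ∑ st : Bits p × Bits p,
      variance (fun z : ℂ => (sampleCoeff β γ st * z).re)
        (weightLaw n β γ l st.1 st.2).toMeasure := by
    rw [energySampleLaw, variance_map aemeasurable_id
      (measurable_energyOfWeights β γ).aemeasurable,
      ← variance_sum_pi fun st => memLp_re_mul_weight hn β γ hl.nodup (sampleCoeff β γ st) st]
    congr 1
    funext M
    simp only [Function.comp_apply, id, energyOfWeights_eq, Finset.sum_apply]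
  rw [hvar, varianceBound, ← hRdef, Fintype.sum_prod_type, Finset.mul_sum]
  refine Finset.sum_le_sum fun s _ => ?_
  rw [Finset.mul_sum]
  refine Finset.sum_le_sum fun t _ => ?_
  set μ := (weightLaw n β γ l s t).toMeasure
  set c := sampleCoeff β γ (s, t) with hc
  have hmem := memLp_re_mul_weight hn β γ hl.nodup c (s, t)
  have hsq : Integrable (fun z : ℂ => ‖z‖ ^ 2) μ :=
    (memLp_weightLaw hn β γ hl.nodup s t).integrable_norm_pow two_ne_zero
  have h1 : variance (fun z : ℂ => (c * z).re) μ ≤ ∫ z, ‖c‖ ^ 2 * ‖z‖ ^ 2 ∂μ := by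
    refine (variance_le_expectation_sq hmem.aestronglyMeasurable).trans ?_
    refine integral_mono hmem.integrable_sq (hsq.const_mul _) fun z => ?_
    have h2 := Complex.abs_re_le_norm (c * z)
    have h3 : (c * z).re ^ 2 ≤ ‖c * z‖ ^ 2 := by
      rw [← sq_abs]
      exact pow_le_pow_left₀ (abs_nonneg _) h2 2
    rw [norm_mul, mul_pow] at h3
    exact h3
  rw [integral_const_mul] at h1
  have h4 := integral_sq_norm_weightLaw_le hn β γ hl.nodup hR s t
  have h5 : growth β γ R l s * growth β γ R l t ≤ R s * R t :=
    mul_le_mul (hgrow s) (hgrow t) (growth_pos _ _ _ _ _).le (hR0 s)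
  have h6 : variance (fun z : ℂ => (c * z).re) μ ≤ ‖c‖ ^ 2 * (R s * R t) :=
    h1.trans (mul_le_mul_of_nonneg_left (h4.trans h5) (by positivity))
  refine h6.trans ?_
  rw [hc, norm_sampleCoeff]
  simp only
  have hBs := norm_bCoeff_le_one β s
  have hBt := norm_bCoeff_le_one β t
  have hs2 : ‖bCoeff β s‖ ^ 2 ≤ ‖bCoeff β s‖ := by nlinarith [norm_nonneg (bCoeff β s)]
  have ht2 : ‖bCoeff β t‖ ^ 2 ≤ ‖bCoeff β t‖ := by nlinarith [norm_nonneg (bCoeff β t)]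
  have hRR : 0 ≤ |phase γ (bxor s t)| ^ 2 * (R s * R t) :=
    mul_nonneg (by positivity) (mul_nonneg (hR0 s) (hR0 t))
  have h7 : ‖bCoeff β s‖ ^ 2 * ‖bCoeff β t‖ ^ 2 ≤ ‖bCoeff β s‖ * ‖bCoeff β t‖ :=
    mul_le_mul hs2 ht2 (by positivity) (norm_nonneg _)
  have h8 := mul_le_mul_of_nonneg_right h7 hRR
  have h9 : 0 ≤ ‖bCoeff β s‖ * ‖bCoeff β t‖ * (|phase γ (bxor s t)| ^ 2 * (R s * R t)) :=
    mul_nonneg (by positivity) hRR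
  -- The squared coefficient carries 1/64 and |B|²; the claimed bound only needs 1/8 and |B|, as |B|
  -- ≤ 1.
  calc (1 / 8 * (‖bCoeff β s‖ * ‖bCoeff β t‖ * |phase γ (bxor s t)|)) ^ 2 * (R s * R t)
      = 1 / 64 * (‖bCoeff β s‖ ^ 2 * ‖bCoeff β t‖ ^ 2 *
          (|phase γ (bxor s t)| ^ 2 * (R s * R t))) := by ring
    _ ≤ 1 / 8 * (‖bCoeff β s‖ * ‖bCoeff β t‖ *
          (|phase γ (bxor s t)| ^ 2 * (R s * R t))) := by linarith
    _ = _ := by ring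

end EnergySample

end

end SKQAOA

open SKQAOA in
/-- The output of the sampling algorithm has mean the instance-averaged QAOA energy per spin, and
its variance is at most the output of the bounding algorithm, whether the sum in the first
exponential of that algorithm is unweighted or carries the weights `|B_{β, t}| ≤ 1`. -/
theorem theorem3 (n p : ℕ) (hn : 2 ≤ n) (hp : 1 ≤ p) (β γ : Fin p → ℝ)
    (l : List (Bits p)) (hl : IsOddList l) :
    IsProbabilityMeasure (energySampleLaw n β γ l) ∧
    MeasureTheory.MemLp id 2 (energySampleLaw n β γ l) ∧
    MeasureTheory.Integrable (qaoaEnergyPerSpin (n := n) β γ) (skMeasure n) ∧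
    ((∫ x, x ∂(energySampleLaw n β γ l) : ℝ) : ℂ)
      = ∫ J, qaoaEnergyPerSpin β γ J ∂(skMeasure n) ∧
    ProbabilityTheory.variance id (energySampleLaw n β γ l)
      ≤ varianceBound (fun _ => 1) β γ l ∧
    ProbabilityTheory.variance id (energySampleLaw n β γ l)
      ≤ varianceBound (fun t => ‖bCoeff β t‖) β γ l := by
  have hn0 : 0 < n := by omega
  refine ⟨isProbabilityMeasure_energySampleLaw β γ l, memLp_energySampleLaw hn0 β γ hl.nodup,
    integrable_qaoaEnergyPerSpin β γ, ?_,
    variance_energySampleLaw_le hn0 β γ hl (norm_bCoeff_le_one β),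
    variance_energySampleLaw_le hn0 β γ hl fun _ => le_rfl⟩
  rw [integral_energySampleLaw hn β γ hl]
  -- The sample estimates a real part; nothing is lost, because the energy is real for every J.
  apply Complex.conj_eq_iff_re.1
  rw [← integral_conj]
  simp only [star_qaoaEnergyPerSpin]
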